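/- Let $X=\{X(h):h\in\mathfrak H\}$ be a centered isonormal Gaussian process over a real separable Hilbert space $\mathfrak H$, i.e. a jointly Gaussian family of centered random variables on a probability space $(\Omega,\mathscr F,P)$ with $E[X(h)X(k)]=\langle h,k\rangle_{\mathfrak H}$. Let $D$ be the Malliavin derivative of $X$ (the closure in $L^2(\Omega)\times L^2(\Omega;\mathfrak H)$ of $f(X(\phi_1),\dots,X(\phi_n))\mapsto\sum_i\partial_i f(X(\phi_1),\dots,X(\phi_n))\,\phi_i$, $f\in C_c^\infty(\mathbb R^n)$), let $\mathbb D^{1,2}$ be its domain, and let $L^{-1}Z=-\sum_{m\ge1}\frac1m J_mZ$, where $J_m$ is the orthogonal projection of $L^2(\Omega)$ onto the $m$-th Wiener chaos of $X$. Let $Z\in\mathbb D^{1,2}$ have zero mean, let $g$ be a Borel function with $g(Z)=E\big(\langle DZ,-DL^{-1}Z\rangle_{\mathfrak H}\,\big|\,Z\big)$ almost surely, i.e. $g(z)=E(\langle DZ,-DL^{-1}Z\rangle_{\mathfrak H}\mid Z=z)$, and assume that $g(Z)\ge\sigma_{\min}^2$ almost surely for some $\sigma_{\min}>0$. Then $Z$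 has a density $\rho$ with respect to Lebesgue measure, and the following hold. (a) Let $\alpha>0$ and $\beta>1$. If (some version of) $\rho$ is such that $x\mapsto x^{1+\beta}\rho(x)$ is decreasing (not necessarily strictly) on $[\alpha,\infty)$, then for all $z\ge\alpha$ $$P(Z\ge z)\ \ge\ \frac12\Big(1-\frac1\beta\Big)\,E|Z|\,\frac1z\,\exp\Big(-\frac{z^2}{2\sigma_{\min}^2}\Big).$$ (b) If, instead, $\limsup_{z\to\infty}z^{-\alpha}\log g(z)<\infty$ for some $0<\alpha<2$, then for every $0<\varepsilon<2$ there exist $K,z_0>0$ such that for all $z>z_0$ $$P(Z\ge z)\ \ge\ K\exp\Big(-\frac{z^2}{(2-\varepsilon)\sigma_{\min}^2}\Big).$$ -/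

import Mathlib

open MeasureTheory ProbabilityTheory Filter Topology

noncomputable section

namespace Malliavin

variable {Ω : Type*} [MeasurableSpace Ω] {H : Type*} [NormedAddCommGroup H]
  [InnerProductSpace ℝ H]

/-- `X = {X(h) : h ∈ H}` is a centered isonormal Gaussian process over the Hilbert space `H`:
a family of jointly Gaussian, centered random variables with `E[X(h) X(k)] = ⟨h, k⟩`. -/
structure IsIsonormal (X : H → Ω → ℝ) (μ : Measure Ω) : Prop where
  gaussian : IsGaussianProcess X μ
  centered : ∀ h : H, ∫ ω, X h ω ∂μ = 0
  covariance : ∀ h k : H, ∫ ω, X h ω * X k ω ∂μ = inner ℝ h k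

/-- The graph of the Malliavin derivative on smooth cylindrical random variables: the pairs
`(F, DF)` with `F = f(X(φ₁), …, X(φₙ))`, `f : ℝⁿ → ℝ` smooth with compact support, and
`DF = ∑ᵢ ∂ᵢf(X(φ₁), …, X(φₙ)) φᵢ`. -/
def cylindricalGraph (X : H → Ω → ℝ) (μ : Measure Ω) : Set (Lp ℝ 2 μ × Lp H 2 μ) :=
  {p | ∃ (n : ℕ) (φ : Fin n → H) (f : (Fin n → ℝ) → ℝ),
    ContDiff ℝ ((⊤ : ℕ∞) : WithTop ℕ∞) f ∧ HasCompactSupport f ∧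
    (p.1 : Ω → ℝ) =ᵐ[μ] (fun ω => f (fun i => X (φ i) ω)) ∧
    (p.2 : Ω → H) =ᵐ[μ] (fun ω =>
      ∑ i, (fderiv ℝ f (fun j => X (φ j) ω) (Pi.single i 1)) • φ i)}

/-- The graph of the closed Malliavin derivative operator: the closure of the cylindrical graph
in `L²(Ω) × L²(Ω; H)`, that is, for the norm `‖·‖_{1,2}`. -/
def derivGraph (X : H → Ω → ℝ) (μ : Measure Ω) : Set (Lp ℝ 2 μ × Lp H 2 μ) :=
  closure (cylindricalGraph X μ)

/-- The space `𝔻^{1,2}`: the domain of the Malliavin derivative. -/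
def D12 (X : H → Ω → ℝ) (μ : Measure Ω) : Set (Lp ℝ 2 μ) :=
  {Z | ∃ u : Lp H 2 μ, (Z, u) ∈ derivGraph X μ}

open Classical in
/-- The Malliavin derivative `DZ` of `Z ∈ 𝔻^{1,2}` (and `0` for `Z` outside `𝔻^{1,2}`). For an
isonormal process the operator on cylindrical variables is closable, so that `DZ` is the only
`u` with `(Z, u)` in the graph. -/
def deriv (X : H → Ω → ℝ) (μ : Measure Ω) (Z : Lp ℝ 2 μ) : Lp H 2 μ :=
  if h : ∃ u : Lp H 2 μ, (Z, u) ∈ derivGraph X μ then h.choose else 0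

/-- The `m`-th Wiener chaos: the closed linear span in `L²(Ω)` of the variables `Heₘ(X(h))` with
`‖h‖ = 1`, where `Heₘ` is the `m`-th (probabilists') Hermite polynomial. For `m = 0` the restriction
on `h` is dropped, which gives the constants, also when `H` is trivial. -/
abbrev chaos (X : H → Ω → ℝ) (μ : Measure Ω) (m : ℕ) : Submodule ℝ (Lp ℝ 2 μ) :=
  (Submodule.span ℝ {F : Lp ℝ 2 μ | ∃ h : H, (m = 0 ∨ ‖h‖ = 1) ∧
    (F : Ω → ℝ) =ᵐ[μ] fun ω => Polynomial.aeval (X h ω) (Polynomial.hermite m)}).topologicalClosure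

/-- `Jₘ`, the orthogonal projection of `L²(Ω)` onto the `m`-th Wiener chaos. -/
def chaosProj (X : H → Ω → ℝ) (μ : Measure Ω) (m : ℕ) : Lp ℝ 2 μ →L[ℝ] Lp ℝ 2 μ :=
  (chaos X μ m).starProjection

/-- The pseudo-inverse `L⁻¹Z = ∑_{m ≥ 1} -(1/m) Jₘ Z` of the Ornstein-Uhlenbeck generator `L`
(a sum of orthogonal vectors that converges in `L²(Ω)`). -/
def invL (X : H → Ω → ℝ) (μ : Measure Ω) (Z : Lp ℝ 2 μ) : Lp ℝ 2 μ :=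
  ∑' m : ℕ, (-(1 / ((m : ℝ) + 1))) • chaosProj X μ (m + 1) Z

/-- The random variable `⟨DZ, -DL⁻¹Z⟩`. -/
def carre (X : H → Ω → ℝ) (μ : Measure Ω) (Z : Lp ℝ 2 μ) (ω : Ω) : ℝ :=
  inner ℝ (deriv X μ Z ω) (-(deriv X μ (invL X μ Z) ω))

/-- `g` is a version of the function `z ↦ E(⟨DZ, -DL⁻¹Z⟩ | Z = z)`, which is defined up to
almost everywhere equality for the law of `Z`: `g` is Borel and
`g(Z) = E(⟨DZ, -DL⁻¹Z⟩ | σ(Z))` almost surely. -/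
def IsG (X : H → Ω → ℝ) (μ : Measure Ω) (Z : Lp ℝ 2 μ) (g : ℝ → ℝ) : Prop :=
  Measurable g ∧
    (fun ω => g (Z ω)) =ᵐ[μ]
      condExp (MeasurableSpace.comap (Z : Ω → ℝ) inferInstance) μ (carre X μ Z)

end Malliavin

/-- `ρ` is a (version of the) density of the real random variable `Z` with respect to Lebesgue
measure. -/
def IsDensityOf {Ω : Type*} [MeasurableSpace Ω] (ρ : ℝ → ℝ) (Z : Ω → ℝ) (μ : Measure Ω) : Prop :=
  Measurable ρ ∧ (∀ x, 0 ≤ ρ x) ∧ μ.map Z = volume.withDensity (fun x => ENNReal.ofReal (ρ x))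

end

noncomputable section

/-! Let ν be the law of Z. On the Gaussian side, the divergence of `-DL⁻¹Z` is Z, in the weak form
E⟨DF, -DL⁻¹Z⟩ = E[FZ] for F in the domain of D (`invL_spec`). With the chain rule and conditioning
on Z this gives ∫ f(x) x dν = ∫ f' g dν for smooth f with bounded derivative (`IsG.integral_law`).

On the real line, Fubini and the centering of ν give ∫ f(x) x dν = ∫ f'(y) T(y) dy, where T(y) is
the integral of x over [y, ∞) against ν. Hence g ν = T dy (`withDensity_eq`), and since g ≥ σ² > 0
the law ν is absolutely continuous.

The same identity gives the Gaussian lower bound. For 0 ≤ a ≤ b, σ² times the ν-integral of x over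
[a, b) is at most the integral of x T(x) over [a, b), hence at most T(a)(b² - a²)/2 because T
decreases on [0, ∞). So T(b) ≥ T(a)(1 - (b² - a²)/(2σ²)). Iterating over points with equally spaced
squares and refining yields T(z) ≥ T(0) exp(-z²/(2σ²)) with T(0) = E|Z|/2 (`tail_lower_bound`).
Neither continuity of T nor a differential inequality is needed.

It remains to pass from T to P(Z ≥ z). In (a) the monotonicity gives (1 - 1/β) T(z) ≤ z P(Z ≥ z) by
comparing ρ with a power law. In (b), integrating g ν = T dy over [z, z+1) gives T(z+1) ≤ sup g ·
P(Z ≥ z); the loss is subgaussian and is absorbed by ε.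

For `invL_spec`, Gaussian integration by parts makes D closable and makes Hermite variables weak
eigenvectors of δD. This property passes to the closed chaoses and makes them orthogonal. A Fourier
argument shows that they are total in the domain of D, so the series for `L⁻¹Z` can be
differentiated term by term. -/

/-! ### Functions of temperate growth under Gaussian laws. -/

theorem Function.HasTemperateGrowth.fderiv' {E F : Type*} [NormedAddCommGroup E] [NormedSpace ℝ E]
    [NormedAddCommGroup F] [NormedSpace ℝ F] {f : E → F} (hf : f.HasTemperateGrowth) :
    (fderiv ℝ f).HasTemperateGrowth := by
  refine ⟨hf.1.fderiv_right (by simp), fun n => ?_⟩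
  obtain ⟨k, C, h⟩ := hf.2 (n + 1)
  exact ⟨k, C, fun x => by simpa only [norm_iteratedFDeriv_fderiv] using h x⟩

theorem Function.HasTemperateGrowth.fderiv_apply {E F : Type*} [NormedAddCommGroup E]
    [NormedSpace ℝ E] [NormedAddCommGroup F] [NormedSpace ℝ F] {f : E → F}
    (hf : f.HasTemperateGrowth) (v : E) :
    (fun x => _root_.fderiv ℝ f x v).HasTemperateGrowth :=
  ((ContinuousLinearMap.apply ℝ F v).hasTemperateGrowth).comp hf.fderiv'

/-- Polynomial growth against Gaussian moments of every order; this settles all integrability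
questions for smooth functionals. -/
theorem Function.HasTemperateGrowth.memLp_comp {Ω E F : Type*} [MeasurableSpace Ω] {μ : Measure Ω}
    [NormedAddCommGroup E] [NormedSpace ℝ E] [MeasurableSpace E] [BorelSpace E] [CompleteSpace E]
    [SecondCountableTopology E] [NormedAddCommGroup F] [NormedSpace ℝ F] {f : E → F}
    (hf : f.HasTemperateGrowth) {V : Ω → E} (hV : HasGaussianLaw V μ) {p : ENNReal} (hp : p ≠ ⊤) :
    MemLp (fun ω => f (V ω)) p μ := by
  have := hV.isProbabilityMeasure
  obtain ⟨k, C, hC, h⟩ := hf.norm_iteratedFDeriv_le_uniform 0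
  have hb : ∀ x, ‖f x‖ ≤ C * (1 + ‖x‖) ^ k := by simpa using h 0
  have hm : AEStronglyMeasurable (fun ω => f (V ω)) μ :=
    hf.1.continuous.comp_aestronglyMeasurable hV.aemeasurable.aestronglyMeasurable
  have h1 : MemLp (fun ω => (1 + ‖V ω‖) ^ k) p μ := by
    rcases Nat.eq_zero_or_pos k with rfl | hk
    · simpa using memLp_const (1 : ℝ)
    -- The `p * k`-th moment of the base is the `p`-th moment of its `k`-th power; dividing by `k`
    -- is why `k = 0` is set apart.
    have h2 : MemLp (fun ω => 1 + ‖V ω‖) (p * k) μ :=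
      (memLp_const (1 : ℝ)).add (hV.memLp (ENNReal.mul_ne_top hp (by simp))).norm
    have h3 := h2.norm_rpow_div (k : ENNReal)
    rw [ENNReal.mul_div_cancel_right (by simpa using hk.ne') (by simp)] at h3
    refine h3.congr_norm
      ((aestronglyMeasurable_const.add hV.aemeasurable.aestronglyMeasurable.norm).pow k) (.of_forall fun ω => ?_)
    simp
  refine (h1.const_mul C).mono hm (.of_forall fun ω => (hb _).trans (le_abs_self _))

/-- Stein's identity for a centered real Gaussian law. -/
theorem integral_id_mul_gaussianReal {v : NNReal} {f : ℝ → ℝ} (hf : f.HasTemperateGrowth) :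
    ∫ x, x * f x ∂gaussianReal 0 v = v * ∫ x, fderiv ℝ f x 1 ∂gaussianReal 0 v := by
  by_cases hv : v = 0
  · simp [hv, gaussianReal_zero_var]
  have hid : HasGaussianLaw (id : ℝ → ℝ) (gaussianReal 0 v) := IsGaussian.hasGaussianLaw_id
  have key : ∀ F : ℝ → ℝ, F.HasTemperateGrowth → Integrable (fun x => F x * gaussianPDFReal 0 v x) := by
    intro F hF
    have h1 : Integrable F (gaussianReal 0 v) :=
      memLp_one_iff_integrable.1 (hF.memLp_comp hid (by simp))
    rw [gaussianReal_of_var_ne_zero _ hv, integrable_withDensity_iff_integrable_smul₀'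
      (by fun_prop) (by simp [gaussianPDF])] at h1
    refine h1.congr (.of_forall fun x => ?_)
    simp [toReal_gaussianPDF, mul_comm]
  have hpdf : ∀ x : ℝ, HasDerivAt (gaussianPDFReal 0 v) (-(x / v) * gaussianPDFReal 0 v x) x := by
    intro x
    have h1 : HasDerivAt (fun x : ℝ => -(x - 0) ^ 2 / (2 * (v : ℝ))) (-(x / v)) x := by
      have hv' : (v : ℝ) ≠ 0 := by simpa using hv
      have := (((hasDerivAt_id x).sub_const 0).pow 2).neg.div_const (2 * (v : ℝ))
      refine this.congr_deriv ?_
      simp only [id]; field_simp; ring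
    have := (h1.exp).const_mul ((√(2 * Real.pi * v))⁻¹)
    rw [gaussianPDFReal_def]
    refine this.congr_deriv ?_
    ring
  have hd : Differentiable ℝ f := hf.1.differentiable (by simp)
  have hibp := integral_mul_deriv_eq_deriv_mul_of_integrable (u := f)
    (u' := fun x => fderiv ℝ f x 1) (v := gaussianPDFReal 0 v)
    (v' := fun x => -(x / v) * gaussianPDFReal 0 v x)
    (fun x _ => (hd x).hasFDerivAt.hasDerivAt) (fun x _ => hpdf x)
    (by
      have := key (fun x => f x * x) (hf.mul .id')
      refine (this.mul_const (-(1 / (v : ℝ)))).congr (.of_forall fun x => ?_)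
      simp only [Pi.mul_apply]; ring)
    (key _ (hf.fderiv_apply 1)) (key _ hf)
  have hv' : (v : ℝ) ≠ 0 := by simpa using hv
  rw [integral_gaussianReal_eq_integral_smul hv, integral_gaussianReal_eq_integral_smul hv]
  have e1 : ∫ x, f x * (-(x / v) * gaussianPDFReal 0 v x)
      = -(1 / (v : ℝ)) * ∫ x, gaussianPDFReal 0 v x • (x * f x) := by
    rw [← integral_const_mul]; congr 1; ext x; simp only [smul_eq_mul]; ring
  have e2 : ∫ x, fderiv ℝ f x 1 * gaussianPDFReal 0 v x
      = ∫ x, gaussianPDFReal 0 v x • fderiv ℝ f x 1 := by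
    congr 1; ext x; simp only [smul_eq_mul]; ring
  rw [e1, e2] at hibp
  field_simp at hibp
  linarith

theorem ContinuousLinearMap.apply_eq_sum_single {n : ℕ} (L : (Fin n → ℝ) →L[ℝ] ℝ) (c : Fin n → ℝ) :
    L c = ∑ i, c i * L (Pi.single i 1) := by
  conv_lhs => rw [← Finset.univ_sum_single c, map_sum]
  refine Finset.sum_congr rfl fun i _ => ?_
  rw [← smul_eq_mul, ← map_smul]
  congr 1
  ext j
  by_cases h : j = i
  · subst h; simp
  · simp [h]

/-! ### Gaussian integration by parts for an isonormal process. -/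

namespace Malliavin

variable {Ω : Type*} [MeasurableSpace Ω] {H : Type*} [NormedAddCommGroup H]
  [InnerProductSpace ℝ H] {X : H → Ω → ℝ} {μ : Measure Ω}

theorem IsIsonormal.hasGaussianLaw_vec (hX : IsIsonormal X μ) {n : ℕ} (φ : Fin n → H) :
    HasGaussianLaw (fun ω i => X (φ i) ω) μ := by
  have h := (hX.gaussian.comp_right φ).hasGaussianLaw Finset.univ
  exact h.map (ContinuousLinearMap.pi fun i : Fin n =>
    ContinuousLinearMap.proj (R := ℝ) (⟨i, Finset.mem_univ i⟩ : (Finset.univ : Finset (Fin n))))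

theorem IsIsonormal.memLp (hX : IsIsonormal X μ) (h : H) {p : ENNReal} (hp : p ≠ ⊤) :
    MemLp (X h) p μ := (hX.gaussian.hasGaussianLaw_eval h).memLp hp

theorem IsIsonormal.covariance_eq (hX : IsIsonormal X μ) [IsProbabilityMeasure μ] (h k : H) :
    cov[X h, X k; μ] = inner ℝ h k := by
  rw [covariance_eq_sub (hX.memLp h (by simp)) (hX.memLp k (by simp)), hX.centered, hX.centered]
  simpa using hX.covariance h k

theorem IsIsonormal.map_eq_gaussianReal (hX : IsIsonormal X μ) [IsProbabilityMeasure μ] (h : H) :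
    μ.map (X h) = gaussianReal 0 (‖h‖₊ ^ 2) := by
  rw [(hX.gaussian.hasGaussianLaw_eval h).map_eq_gaussianReal, hX.centered,
    ← covariance_self (hX.gaussian.aemeasurable h), hX.covariance_eq]
  congr 1
  ext
  simp

theorem IsIsonormal.zero_ae (hX : IsIsonormal X μ) [IsProbabilityMeasure μ] :
    X 0 =ᵐ[μ] 0 := by
  have h := hX.map_eq_gaussianReal 0
  simp only [nnnorm_zero, ne_eq, OfNat.ofNat_ne_zero, not_false_eq_true, zero_pow,
    gaussianReal_zero_var] at h
  have h2 : ∀ᵐ x ∂(μ.map (X 0)), x = 0 := by rw [h]; simp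
  exact ae_of_ae_map (hX.gaussian.aemeasurable 0) h2

/-- Gaussian integration by parts for functions of finitely many variables of the process. -/
theorem IsIsonormal.integral_mul_comp (hX : IsIsonormal X μ) [IsProbabilityMeasure μ] {n : ℕ}
    (φ : Fin n → H) {f : (Fin n → ℝ) → ℝ} (hf : f.HasTemperateGrowth) (h : H) :
    ∫ ω, X h ω * f (fun i => X (φ i) ω) ∂μ
      = ∫ ω, ∑ i, inner ℝ h (φ i) * fderiv ℝ f (fun i => X (φ i) ω) (Pi.single i 1) ∂μ := by
  by_cases h0 : h = 0
  · subst h0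
    have : ∫ ω, X 0 ω * f (fun i => X (φ i) ω) ∂μ = ∫ ω, 0 ∂μ :=
      integral_congr_ae (by filter_upwards [hX.zero_ae] with ω hω; simp [hω])
    simp [this]
  have hv : ‖h‖ ^ 2 ≠ 0 := by positivity
  -- Regression coefficients: `X (φ i) - c i * X h` is uncorrelated with `X h`, hence independent of
  -- it by joint Gaussianity. For a fixed value of this residual the one-dimensional Stein identity
  -- applies in the variable `X h`.
  set c : Fin n → ℝ := fun i => inner ℝ h (φ i) / ‖h‖ ^ 2 with hc
  let L : (Fin (n + 1) → ℝ) →L[ℝ] (Fin n → ℝ) × (Fin 1 → ℝ) :=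
    (ContinuousLinearMap.pi fun i : Fin n =>
      ContinuousLinearMap.proj (R := ℝ) (φ := fun _ : Fin (n + 1) => ℝ) i.succ
        - c i • ContinuousLinearMap.proj (R := ℝ) (φ := fun _ : Fin (n + 1) => ℝ) 0).prod
    (ContinuousLinearMap.pi fun _ =>
      ContinuousLinearMap.proj (R := ℝ) (φ := fun _ : Fin (n + 1) => ℝ) 0)
  have hjoint : HasGaussianLaw (fun ω => ((fun i => X (φ i) ω - c i * X h ω : Fin n → ℝ),
      (fun _ => X h ω : Fin 1 → ℝ))) μ := by
    exact (hX.hasGaussianLaw_vec (Fin.cons h φ : Fin (n + 1) → H)).map L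
  have hind := hjoint.indepFun_of_covariance_eval (X := fun i ω => X (φ i) ω - c i * X h ω)
    (Y := fun _ ω => X h ω) (by
      intro i _
      have hm := fun k => hX.memLp k (p := 2) (by simp)
      rw [covariance_fun_sub_left (hm _) ((hm _).const_mul _) (hm _),
        covariance_const_mul_left, hX.covariance_eq, hX.covariance_eq,
        real_inner_self_eq_norm_sq, hc, real_inner_comm]
      field_simp
      simp)
  have hind2 : IndepFun (fun ω i => X (φ i) ω - c i * X h ω : Ω → Fin n → ℝ) (X h) μ :=
    hind.comp (φ := id) (ψ := fun y : Fin 1 → ℝ => y 0) measurable_id (measurable_pi_apply 0)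
  have hYm : AEMeasurable (fun ω i => X (φ i) ω - c i * X h ω : Ω → Fin n → ℝ) μ :=
    hjoint.fst.aemeasurable
  have hWm : AEMeasurable (X h) μ := hX.gaussian.aemeasurable h
  have hmap := (indepFun_iff_map_prod_eq_prod_map_map hYm hWm).1 hind2
  have hpair : HasGaussianLaw (fun ω => ((fun i => X (φ i) ω - c i * X h ω : Fin n → ℝ), X h ω)) μ :=
    hjoint.map ((ContinuousLinearMap.id ℝ (Fin n → ℝ)).prodMap
      (ContinuousLinearMap.proj (R := ℝ) (φ := fun _ : Fin 1 => ℝ) 0))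
  have hpm := hpair.aemeasurable
  have := hjoint.fst.isGaussian_map
  set Y : Ω → Fin n → ℝ := fun ω i => X (φ i) ω - c i * X h ω with hY
  have key : ∀ F : (Fin n → ℝ) × ℝ → ℝ, F.HasTemperateGrowth →
      Integrable F ((μ.map Y).prod (gaussianReal 0 (‖h‖₊ ^ 2))) ∧ 
      ∫ ω, F (Y ω, X h ω) ∂μ = ∫ y, ∫ x, F (y, x) ∂gaussianReal 0 (‖h‖₊ ^ 2) ∂(μ.map Y) := by
    intro F hF
    have hi : Integrable F ((μ.map Y).prod (gaussianReal 0 (‖h‖₊ ^ 2))) := by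
      rw [← hX.map_eq_gaussianReal h, ← hmap]
      rw [integrable_map_measure hF.1.continuous.aestronglyMeasurable hpm]
      exact memLp_one_iff_integrable.1 (hF.memLp_comp hpair (by simp))
    refine ⟨hi, ?_⟩
    rw [← integral_prod _ hi, ← hX.map_eq_gaussianReal h, ← hmap,
      integral_map hpm hF.1.continuous.aestronglyMeasurable]
  have hvec : ∀ ω, (fun i => X (φ i) ω) = Y ω + X h ω • c := by
    intro ω; ext i; simp [hY]; ring
  let A : (Fin n → ℝ) × ℝ →L[ℝ] (Fin n → ℝ) := ContinuousLinearMap.fst ℝ _ _ +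
    (ContinuousLinearMap.snd ℝ (Fin n → ℝ) ℝ).smulRight c
  have hA : ∀ y x, A (y, x) = y + x • c := fun y x => by simp [A]
  have hF1 := (key (fun q => q.2 * f (A q))
    (((ContinuousLinearMap.snd ℝ (Fin n → ℝ) ℝ).hasTemperateGrowth).mul
      (hf.comp A.hasTemperateGrowth))).2
  have hF2 := (key (fun q => ‖h‖ ^ 2 * fderiv ℝ f (A q) c)
    ((Function.HasTemperateGrowth.const _).mul
      ((hf.fderiv_apply c).comp A.hasTemperateGrowth))).2
  -- Stein's identity on the line `x ↦ y + x • c` produces the derivative in direction `c`, and `‖h‖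
  -- ^ 2 * c i` is the inner product of `h` and `φ i`.
  have e1 : ∫ ω, X h ω * f (fun i => X (φ i) ω) ∂μ = ∫ ω, ‖h‖ ^ 2 *
      fderiv ℝ f (fun i => X (φ i) ω) c ∂μ := by
    simp only [hvec, ← hA]
    rw [hF1, hF2]
    congr 1
    ext y
    have ht : (fun x : ℝ => f (y + x • c)).HasTemperateGrowth := by
      have := hf.comp (((Function.HasTemperateGrowth.const (E := ℝ) y)).add
        ((ContinuousLinearMap.toSpanSingleton ℝ c).hasTemperateGrowth))
      exact this
    have := integral_id_mul_gaussianReal (v := ‖h‖₊ ^ 2) ht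
    simp only [hA]
    rw [this, integral_const_mul]
    congr 1
    congr 1
    ext x
    have hd : HasFDerivAt f (fderiv ℝ f (y + x • c)) (y + x • c) :=
      (hf.1.differentiable (by simp) _).hasFDerivAt
    have hl : HasDerivAt (fun x : ℝ => y + x • c) c x := by
      simpa using ((hasDerivAt_id x).smul_const c).const_add y
    have := (hd.comp_hasDerivAt x hl).deriv
    rw [← this]
    simp [Function.comp_def]
  rw [e1]
  congr 1
  ext ω
  rw [ContinuousLinearMap.apply_eq_sum_single, Finset.mul_sum]
  refine Finset.sum_congr rfl fun i _ => ?_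
  simp only [hc]
  field_simp

end Malliavin

/-! ### Hermite polynomials. -/

theorem Polynomial.derivative_hermite_succ (n : ℕ) :
    derivative (hermite (n + 1)) = (n + 1 : Polynomial ℤ) * hermite n := by
  induction n with
  | zero => simp
  | succ n ih =>
    rw [hermite_succ (n + 1), derivative_sub, derivative_mul, derivative_X, ih, derivative_mul]
    have h := hermite_succ n
    simp only [derivative_add, derivative_natCast, derivative_one]
    push_cast
    linear_combination (-(n + 1 : Polynomial ℤ)) * h

/-- The Hermite differential equation: the left side is the one-dimensional Ornstein-Uhlenbeck
operator `-L`, and it is the source of the eigenvalue `m` on the `m`-th chaos. -/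
theorem Polynomial.hermite_eigen (n : ℕ) :
    X * derivative (hermite n) - derivative (derivative (hermite n))
      = (n : Polynomial ℤ) * hermite n := by
  cases n with
  | zero => simp
  | succ n =>
    rw [derivative_hermite_succ, derivative_mul, hermite_succ]
    simp
    ring

/-! ### Calculus and divergence for smooth functionals. -/

namespace Malliavin

variable {Ω : Type*} {H : Type*} [NormedAddCommGroup H] [InnerProductSpace ℝ H] {X : H → Ω → ℝ}

/-- `F = f(X(φ₁), …, X(φₙ))` and `U = ∑ᵢ ∂ᵢf(X(φ₁), …, X(φₙ)) φᵢ`, where `f` has temperate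
growth. -/
def SmoothPair (X : H → Ω → ℝ) (F : Ω → ℝ) (U : Ω → H) : Prop :=
  ∃ (n : ℕ) (φ : Fin n → H) (f : (Fin n → ℝ) → ℝ), f.HasTemperateGrowth ∧
    F = (fun ω => f (fun i => X (φ i) ω)) ∧
    U = (fun ω => ∑ i, (fderiv ℝ f (fun j => X (φ j) ω) (Pi.single i 1)) • φ i)

namespace SmoothPair

variable {F G : Ω → ℝ} {U V : Ω → H}

/-- Composing with a coordinate projection adds dummy variables, whose partial derivatives vanish;
the gradient is unchanged. -/
theorem comp_castAdd (n m : ℕ) (φ : Fin n → H) (ψ : Fin m → H) (f : (Fin n → ℝ) → ℝ)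
    (hf : f.HasTemperateGrowth) : ∃ f' : (Fin (n + m) → ℝ) → ℝ, f'.HasTemperateGrowth ∧
    (∀ ω, f (fun i => X (φ i) ω) = f' (fun i => X (Fin.append φ ψ i) ω)) ∧
    ∀ ω, ∑ i, (fderiv ℝ f (fun j => X (φ j) ω) (Pi.single i 1)) • φ i
      = ∑ i, (fderiv ℝ f' (fun j => X (Fin.append φ ψ j) ω) (Pi.single i 1)) •
        Fin.append φ ψ i := by
  let A : (Fin (n + m) → ℝ) →L[ℝ] (Fin n → ℝ) := ContinuousLinearMap.pi fun i =>
    ContinuousLinearMap.proj (R := ℝ) (φ := fun _ : Fin (n + m) => ℝ) (Fin.castAdd m i)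
  have hA : ∀ ω, A (fun i => X (Fin.append φ ψ i) ω) = fun i => X (φ i) ω := by
    intro ω; ext i; simp [A]
  refine ⟨f ∘ A, hf.comp A.hasTemperateGrowth, fun ω => by simp [hA], fun ω => ?_⟩
  have hd : fderiv ℝ (f ∘ A) (fun j => X (Fin.append φ ψ j) ω)
      = (fderiv ℝ f (fun j => X (φ j) ω)).comp A := by
    rw [fderiv_comp _ (hf.1.differentiable (by simp) _) A.differentiableAt, A.fderiv, hA]
  have h1 : ∀ i : Fin n, A (Pi.single (Fin.castAdd m i) 1) = Pi.single i 1 := by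
    intro i; ext j; simp [A, Pi.single_apply]
  have h2 : ∀ i : Fin m, A (Pi.single (Fin.natAdd n i) 1) = 0 := by
    intro i; ext j; simp [A, Pi.single_apply, Fin.ext_iff]; omega
  rw [Fin.sum_univ_add]
  simp [hd, h1, h2]

theorem comp_natAdd (n m : ℕ) (φ : Fin n → H) (ψ : Fin m → H) (g : (Fin m → ℝ) → ℝ)
    (hg : g.HasTemperateGrowth) : ∃ g' : (Fin (n + m) → ℝ) → ℝ, g'.HasTemperateGrowth ∧
    (∀ ω, g (fun i => X (ψ i) ω) = g' (fun i => X (Fin.append φ ψ i) ω)) ∧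
    ∀ ω, ∑ i, (fderiv ℝ g (fun j => X (ψ j) ω) (Pi.single i 1)) • ψ i
      = ∑ i, (fderiv ℝ g' (fun j => X (Fin.append φ ψ j) ω) (Pi.single i 1)) •
        Fin.append φ ψ i := by
  let A : (Fin (n + m) → ℝ) →L[ℝ] (Fin m → ℝ) := ContinuousLinearMap.pi fun i =>
    ContinuousLinearMap.proj (R := ℝ) (φ := fun _ : Fin (n + m) => ℝ) (Fin.natAdd n i)
  have hA : ∀ ω, A (fun i => X (Fin.append φ ψ i) ω) = fun i => X (ψ i) ω := by
    intro ω; ext i; simp [A]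
  refine ⟨g ∘ A, hg.comp A.hasTemperateGrowth, fun ω => by simp [hA], fun ω => ?_⟩
  have hd : fderiv ℝ (g ∘ A) (fun j => X (Fin.append φ ψ j) ω)
      = (fderiv ℝ g (fun j => X (ψ j) ω)).comp A := by
    rw [fderiv_comp _ (hg.1.differentiable (by simp) _) A.differentiableAt, A.fderiv, hA]
  have h1 : ∀ i : Fin m, A (Pi.single (Fin.natAdd n i) 1) = Pi.single i 1 := by
    intro i; ext j; simp [A, Pi.single_apply]
  have h2 : ∀ i : Fin n, A (Pi.single (Fin.castAdd m i) 1) = 0 := by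
    intro i; ext j; simp [A, Pi.single_apply, Fin.ext_iff]; omega
  rw [Fin.sum_univ_add]
  simp [hd, h1, h2]

/-- Two smooth pairs can be written with the same Gaussian vector. -/
theorem exists_common (hF : SmoothPair X F U) (hG : SmoothPair X G V) :
    ∃ (n : ℕ) (φ : Fin n → H) (f g : (Fin n → ℝ) → ℝ),
      f.HasTemperateGrowth ∧ g.HasTemperateGrowth ∧
      F = (fun ω => f (fun i => X (φ i) ω)) ∧ G = (fun ω => g (fun i => X (φ i) ω)) ∧
      U = (fun ω => ∑ i, (fderiv ℝ f (fun j => X (φ j) ω) (Pi.single i 1)) • φ i) ∧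
      V = (fun ω => ∑ i, (fderiv ℝ g (fun j => X (φ j) ω) (Pi.single i 1)) • φ i) := by
  obtain ⟨n, φ, f, hf, rfl, rfl⟩ := hF
  obtain ⟨m, ψ, g, hg, rfl, rfl⟩ := hG
  obtain ⟨f', hf', h1, h2⟩ := comp_castAdd (X := X) n m φ ψ f hf
  obtain ⟨g', hg', h3, h4⟩ := comp_natAdd (X := X) n m φ ψ g hg
  exact ⟨n + m, Fin.append φ ψ, f', g', hf', hg', funext h1, funext h3, funext h2, funext h4⟩

theorem add (hF : SmoothPair X F U) (hG : SmoothPair X G V) : SmoothPair X (F + G) (U + V) := by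
  obtain ⟨n, φ, f, g, hf, hg, rfl, rfl, rfl, rfl⟩ := exists_common hF hG
  refine ⟨n, φ, f + g, hf.add hg, rfl, ?_⟩
  ext ω
  rw [fderiv_add (hf.1.differentiable (by simp) _) (hg.1.differentiable (by simp) _)]
  simp [add_smul, Finset.sum_add_distrib]

theorem mul (hF : SmoothPair X F U) (hG : SmoothPair X G V) :
    SmoothPair X (F * G) (F • V + G • U) := by
  obtain ⟨n, φ, f, g, hf, hg, rfl, rfl, rfl, rfl⟩ := exists_common hF hG
  refine ⟨n, φ, f * g, hf.mul hg, rfl, ?_⟩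
  ext ω
  rw [fderiv_mul (hf.1.differentiable (by simp) _) (hg.1.differentiable (by simp) _)]
  simp [add_smul, Finset.sum_add_distrib, Finset.smul_sum, mul_smul]

theorem const (X : H → Ω → ℝ) (c : ℝ) : SmoothPair X (fun _ => c) (fun _ => 0) :=
  ⟨0, Fin.elim0, fun _ => c, .const c, rfl, by simp⟩

theorem const_smul (c : ℝ) (hF : SmoothPair X F U) : SmoothPair X (c • F) (c • U) := by
  have := (const X c).mul hF
  convert this using 1
  all_goals ext ω; simp

theorem eval (X : H → Ω → ℝ) (h : H) : SmoothPair X (X h) (fun _ => h) := by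
  refine ⟨1, fun _ => h, fun x => x 0,
    (ContinuousLinearMap.proj (R := ℝ) (φ := fun _ : Fin 1 => ℝ) 0).hasTemperateGrowth, rfl, ?_⟩
  ext ω
  have : fderiv ℝ (fun x : Fin 1 → ℝ => x 0) (fun _ => X h ω)
      = ContinuousLinearMap.proj (R := ℝ) (φ := fun _ : Fin 1 => ℝ) 0 :=
    (ContinuousLinearMap.proj (R := ℝ) (φ := fun _ : Fin 1 => ℝ) 0).fderiv
  simp [this]

theorem aeval (X : H → Ω → ℝ) (h : H) (p : Polynomial ℤ) :
    SmoothPair X (fun ω => Polynomial.aeval (X h ω) p)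
      (fun ω => Polynomial.aeval (X h ω) (Polynomial.derivative p) • h) := by
  induction p using Polynomial.induction_on with
  | C a =>
    convert const X (a : ℝ) using 2
    · simp
    · simp
  | add p q hp hq =>
    convert hp.add hq using 1
    · ext ω; simp
    · ext ω; simp [add_smul]
  | monomial n a ih =>
    convert ih.mul (eval X h) using 1
    · ext ω; simp [pow_succ, mul_assoc]
    · ext ω
      have : (Polynomial.C a * Polynomial.X ^ (n + 1) : Polynomial ℤ)
        = Polynomial.C a * Polynomial.X ^ n * Polynomial.X := by ring
      rw [this, Polynomial.derivative_mul]
      simp only [map_add, map_mul, Polynomial.derivative_X, Polynomial.aeval_X, mul_one,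
        Pi.add_apply, Pi.smul_apply']
      module

/-- The coefficients of a gradient are again smooth functionals, so the divergence can be applied to
it term by term. -/
theorem exists_coordinates (hF : SmoothPair X F U) :
    ∃ (n : ℕ) (φ : Fin n → H) (W : Fin n → Ω → ℝ) (W' : Fin n → Ω → H),
      (∀ i, SmoothPair X (W i) (W' i)) ∧ U = fun ω => ∑ i, W i ω • φ i := by
  obtain ⟨n, φ, f, hf, rfl, rfl⟩ := hF
  exact ⟨n, φ, _, _, fun i => ⟨n, φ, _, hf.fderiv_apply (Pi.single i 1), rfl, rfl⟩, rfl⟩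

variable [MeasurableSpace Ω] {μ : Measure Ω} (hX : IsIsonormal X μ)
include hX

theorem memLp_fst (hF : SmoothPair X F U) {p : ENNReal} (hp : p ≠ ⊤) : MemLp F p μ := by
  obtain ⟨n, φ, f, hf, rfl, rfl⟩ := hF
  exact hf.memLp_comp (hX.hasGaussianLaw_vec φ) hp

theorem memLp_snd (hF : SmoothPair X F U) {p : ENNReal} (hp : p ≠ ⊤) : MemLp U p μ := by
  obtain ⟨n, φ, W, W', hW, rfl⟩ := hF.exists_coordinates
  refine memLp_finsetSum _ fun i _ => ?_
  have h1 := (hW i).memLp_fst hX hp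
  have h2 : AEStronglyMeasurable (fun ω => W i ω • φ i) μ :=
    h1.aestronglyMeasurable.smul_const _
  refine (h1.norm.mul_const ‖φ i‖).mono h2 (.of_forall fun ω => ?_)
  rw [norm_smul]; exact le_abs_self _

variable [IsProbabilityMeasure μ]

theorem integral_mul_eval (hF : SmoothPair X F U) (h : H) :
    ∫ ω, X h ω * F ω ∂μ = ∫ ω, inner ℝ h (U ω) ∂μ := by
  obtain ⟨n, φ, f, hf, rfl, rfl⟩ := hF
  rw [hX.integral_mul_comp φ hf h]
  congr 1
  ext ω
  simp [inner_sum, inner_smul_right, mul_comm]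

/-- The divergence of the elementary vector field `F h` is `F X(h) - ⟨h, DF⟩`. -/
theorem integral_inner_smul (hF : SmoothPair X F U) (hG : SmoothPair X G V) (h : H) :
    ∫ ω, inner ℝ (F ω • h) (V ω) ∂μ = ∫ ω, (X h ω * F ω - inner ℝ h (U ω)) * G ω ∂μ := by
  -- Integration by parts for the product `F * G`; Leibniz's rule yields the wanted term and the
  -- correction.
  have hibp := (hF.mul hG).integral_mul_eval hX h
  have i1 : Integrable (fun ω => X h ω * F ω * G ω) μ := by
    have := (((eval X h).mul hF).mul hG).memLp_fst hX (p := 1) (by simp)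
    exact memLp_one_iff_integrable.1 this
  have i2 : Integrable (fun ω => inner ℝ h (U ω) * G ω) μ := by
    have h1 := (hF.memLp_snd hX (p := 2) (by simp)).const_inner (𝕜 := ℝ) h
    exact h1.integrable_mul (hG.memLp_fst hX (p := 2) (by simp))
  have i3 : Integrable (fun ω => inner ℝ h (V ω) * F ω) μ := by
    have h1 := (hG.memLp_snd hX (p := 2) (by simp)).const_inner (𝕜 := ℝ) h
    exact h1.integrable_mul (hF.memLp_fst hX (p := 2) (by simp))
  have e1 : ∫ ω, inner ℝ h ((F • V + G • U) ω) ∂μ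
      = ∫ ω, (inner ℝ h (V ω) * F ω + inner ℝ h (U ω) * G ω) ∂μ := by
    congr 1; ext ω; simp [inner_add_right, inner_smul_right, mul_comm]
  rw [e1, integral_add i3 i2] at hibp
  have e2 : ∫ ω, (X h ω * F ω - inner ℝ h (U ω)) * G ω ∂μ
      = ∫ ω, (X h ω * F ω * G ω - inner ℝ h (U ω) * G ω) ∂μ := by
    congr 1; ext ω; ring
  rw [e2, integral_sub i1 i2]
  have e3 : ∫ ω, X h ω * (F * G) ω ∂μ = ∫ ω, X h ω * F ω * G ω ∂μ := by
    congr 1; ext ω; simp; ring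
  rw [← e3, hibp]
  simp only [inner_smul_left, conj_trivial]
  rw [add_sub_cancel_right]
  congr 1; ext ω; ring

/-- The gradient of a smooth variable lies in the domain of the divergence. -/
theorem exists_divergence (hF : SmoothPair X F U) : ∃ δ : Ω → ℝ, MemLp δ 2 μ ∧
    ∀ G V, SmoothPair X G V → ∫ ω, inner ℝ (U ω) (V ω) ∂μ = ∫ ω, δ ω * G ω ∂μ := by
  obtain ⟨n, φ, W, W', hW, rfl⟩ := hF.exists_coordinates
  have hm : ∀ i, MemLp (fun ω => X (φ i) ω * W i ω - inner ℝ (φ i) (W' i ω)) 2 μ := fun i =>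
    (((eval X (φ i)).mul (hW i)).memLp_fst hX (by simp)).sub
      (((hW i).memLp_snd hX (by simp)).const_inner _)
  refine ⟨fun ω => ∑ i, (X (φ i) ω * W i ω - inner ℝ (φ i) (W' i ω)),
    memLp_finsetSum _ fun i _ => hm i, fun G V hG => ?_⟩
  simp only [sum_inner, Finset.sum_mul]
  rw [integral_finsetSum, integral_finsetSum]
  · exact Finset.sum_congr rfl fun i _ => (hW i).integral_inner_smul hX hG (φ i)
  · exact fun i _ => (hm i).integrable_mul (hG.memLp_fst hX (p := 2) (by simp))
  · intro i _
    simp only [inner_smul_left, conj_trivial]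
    exact ((hW i).memLp_fst hX (p := 2) (by simp)).integrable_mul
      ((hG.memLp_snd hX (p := 2) (by simp)).const_inner (𝕜 := ℝ) (φ i))

/-- Hermite variables are eigenvectors of the Ornstein-Uhlenbeck operator. -/
theorem integral_inner_hermite (hG : SmoothPair X G V) (m : ℕ) {h : H} (hm : m = 0 ∨ ‖h‖ = 1) :
    ∫ ω, inner ℝ (Polynomial.aeval (X h ω) (Polynomial.derivative (Polynomial.hermite m)) • h)
      (V ω) ∂μ = m * ∫ ω, Polynomial.aeval (X h ω) (Polynomial.hermite m) * G ω ∂μ := by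
  rw [(aeval X h (Polynomial.derivative (Polynomial.hermite m))).integral_inner_smul hX hG,
    ← integral_const_mul]
  congr 1
  ext ω
  rw [← mul_assoc]
  congr 1
  -- With `‖h‖ = 1` the divergence is exactly the left side of `hermite_eigen`; for `m = 0` both
  -- sides vanish for any `h`.
  rcases hm with rfl | hm
  · simp
  · have := congrArg (Polynomial.aeval (X h ω)) (Polynomial.hermite_eigen m)
    simp only [map_sub, map_mul, Polynomial.aeval_X, map_natCast] at this
    rw [← this]
    simp [inner_smul_right, hm]

end SmoothPair

end Malliavin

/-! ### Approximation by cutoffs and closability of the derivative. -/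

theorem MeasureTheory.tendsto_eLpNorm_two_of_dominated {Ω E : Type*} [MeasurableSpace Ω]
    {μ : Measure Ω} [NormedAddCommGroup E] {F : ℕ → Ω → E} {f : Ω → E} {b : Ω → ℝ}
    (hF : ∀ n, AEStronglyMeasurable (F n) μ) (hf : AEStronglyMeasurable f μ) (hb : MemLp b 2 μ)
    (hbound : ∀ n, ∀ᵐ ω ∂μ, ‖F n ω - f ω‖ ≤ b ω)
    (hlim : ∀ᵐ ω ∂μ, Tendsto (fun n => F n ω) atTop (𝓝 (f ω))) :
    Tendsto (fun n => eLpNorm (F n - f) 2 μ) atTop (𝓝 0) := by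
  simp only [eLpNorm_eq_lintegral_rpow_enorm_toReal (p := 2) (by simp) (by simp)]
  have h := tendsto_lintegral_of_dominated_convergence' (μ := μ)
    (F := fun n ω => ‖(F n - f) ω‖ₑ ^ (ENNReal.toReal 2)) (f := fun _ => 0)
    (fun ω => ‖b ω‖ₑ ^ (ENNReal.toReal 2))
    (fun n => (((hF n).sub hf).enorm.pow_const _))
    (fun n => by
      filter_upwards [hbound n] with ω hω
      gcongr
      rw [← ofReal_norm, ← ofReal_norm]
      exact ENNReal.ofReal_le_ofReal (hω.trans (le_abs_self _)))
    (by
      have := lintegral_rpow_enorm_lt_top_of_eLpNorm_lt_top (p := 2) (by simp) (by simp) hb.2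
      exact this.ne)
    (by
      filter_upwards [hlim] with ω hω
      have h1 : Tendsto (fun n => ‖(F n - f) ω‖ₑ) atTop (𝓝 0) := by
        have h2 := (hω.sub_const (f ω)).enorm
        simpa using h2
      have := (ENNReal.continuous_rpow_const (y := ENNReal.toReal 2)).tendsto 0 |>.comp h1
      simpa [Function.comp_def] using this)
  have h3 := (ENNReal.continuous_rpow_const (y := 1 / ENNReal.toReal 2)).tendsto _ |>.comp h
  simpa [Function.comp_def] using h3

theorem MeasureTheory.toLp_mem_of_dominated {Ω H : Type*} [MeasurableSpace Ω]
    {μ : Measure Ω} [NormedAddCommGroup H] {s : Set (Lp ℝ 2 μ × Lp H 2 μ)} (hs : IsClosed s)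
    {F' : ℕ → Ω → ℝ} {U' : ℕ → Ω → H} {F : Ω → ℝ} {U : Ω → H} {b c : Ω → ℝ}
    (hF' : ∀ k, MemLp (F' k) 2 μ) (hU' : ∀ k, MemLp (U' k) 2 μ)
    (hF : MemLp F 2 μ) (hU : MemLp U 2 μ) (hb : MemLp b 2 μ) (hc : MemLp c 2 μ)
    (hFb : ∀ k, ∀ᵐ ω ∂μ, ‖F' k ω - F ω‖ ≤ b ω) (hUc : ∀ k, ∀ᵐ ω ∂μ, ‖U' k ω - U ω‖ ≤ c ω)
    (hFl : ∀ᵐ ω ∂μ, Tendsto (fun k => F' k ω) atTop (𝓝 (F ω)))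
    (hUl : ∀ᵐ ω ∂μ, Tendsto (fun k => U' k ω) atTop (𝓝 (U ω)))
    (hmem : ∀ k, ((hF' k).toLp (F' k), (hU' k).toLp (U' k)) ∈ s) :
    (hF.toLp F, hU.toLp U) ∈ s := by
  have t1 : Tendsto (fun k => (hF' k).toLp (F' k)) atTop (𝓝 (hF.toLp F)) := by
    rw [Lp.tendsto_Lp_iff_tendsto_eLpNorm'']
    exact tendsto_eLpNorm_two_of_dominated (fun k => (hF' k).1) hF.1 hb hFb hFl
  have t2 : Tendsto (fun k => (hU' k).toLp (U' k)) atTop (𝓝 (hU.toLp U)) := by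
    rw [Lp.tendsto_Lp_iff_tendsto_eLpNorm'']
    exact tendsto_eLpNorm_two_of_dominated (fun k => (hU' k).1) hU.1 hc hUc hUl
  exact hs.mem_of_tendsto (t1.prodMk_nhds t2) (.of_forall hmem)

namespace Malliavin

section Deterministic

variable {n : ℕ}

/-- A smooth cutoff function on `ℝⁿ`. -/
def cutoff (n : ℕ) : (Fin n → ℝ) → ℝ :=
  (⟨1, 2, one_pos, one_lt_two⟩ : ContDiffBump (0 : Fin n → ℝ))

theorem contDiff_cutoff (n : ℕ) {k : ℕ∞} : ContDiff ℝ k (cutoff n) := ContDiffBump.contDiff _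

theorem hasCompactSupport_cutoff (n : ℕ) : HasCompactSupport (cutoff n) :=
  ContDiffBump.hasCompactSupport _

theorem cutoff_nonneg (x : Fin n → ℝ) : 0 ≤ cutoff n x := ContDiffBump.nonneg' _ x

theorem cutoff_le_one (x : Fin n → ℝ) : cutoff n x ≤ 1 := ContDiffBump.le_one _

theorem cutoff_zero (n : ℕ) : cutoff n 0 = 1 :=
  ContDiffBump.one_of_mem_closedBall _ (by simp)

theorem differentiable_cutoff (n : ℕ) : Differentiable ℝ (cutoff n) :=
  (contDiff_cutoff n (k := 1)).differentiable (by simp)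

theorem exists_fderiv_cutoff_bound (n : ℕ) :
    ∃ C : ℝ, 0 ≤ C ∧ ∀ x, ‖fderiv ℝ (cutoff n) x‖ ≤ C := by
  have h1 : Continuous (fderiv ℝ (cutoff n)) :=
    (contDiff_cutoff n (k := 1)).continuous_fderiv (by simp)
  obtain ⟨C, hC⟩ := h1.bounded_above_of_compact_support ((hasCompactSupport_cutoff n).fderiv ℝ)
  exact ⟨C, (norm_nonneg _).trans (hC 0), hC⟩

/-- Multiplication of `f` by a cutoff at scale `k + 1`. -/
def truncate (f : (Fin n → ℝ) → ℝ) (k : ℕ) (x : Fin n → ℝ) : ℝ :=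
  cutoff n ((1 / ((k : ℝ) + 1)) • x) * f x

variable {f : (Fin n → ℝ) → ℝ}

theorem contDiff_truncate (hf : ContDiff ℝ ((⊤ : ℕ∞) : WithTop ℕ∞) f) (k : ℕ) :
    ContDiff ℝ ((⊤ : ℕ∞) : WithTop ℕ∞) (truncate f k) :=
  ((contDiff_cutoff n).comp (contDiff_const_smul _)).mul hf

theorem hasCompactSupport_truncate (f : (Fin n → ℝ) → ℝ) (k : ℕ) :
    HasCompactSupport (truncate f k) := by
  have h : HasCompactSupport fun x => cutoff n ((1 / ((k : ℝ) + 1)) • x) :=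
    (hasCompactSupport_cutoff n).comp_smul (by positivity)
  exact h.mul_right

theorem abs_truncate_sub_le (f : (Fin n → ℝ) → ℝ) (k : ℕ) (x : Fin n → ℝ) :
    ‖truncate f k x - f x‖ ≤ ‖f x‖ := by
  have h0 := cutoff_nonneg ((1 / ((k : ℝ) + 1)) • x)
  have h1 := cutoff_le_one ((1 / ((k : ℝ) + 1)) • x)
  rw [truncate, show ∀ a b : ℝ, a * b - b = (a - 1) * b by intros; ring, norm_mul]
  refine mul_le_of_le_one_left (norm_nonneg _) ?_
  rw [Real.norm_eq_abs, abs_le]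
  constructor <;> linarith

theorem tendsto_cutoff (x : Fin n → ℝ) :
    Tendsto (fun k : ℕ => cutoff n ((1 / ((k : ℝ) + 1)) • x)) atTop (𝓝 1) := by
  have h1 : Tendsto (fun k : ℕ => (1 / ((k : ℝ) + 1)) • x) atTop (𝓝 0) := by
    simpa using (tendsto_one_div_add_atTop_nhds_zero_nat (𝕜 := ℝ)).smul_const x
  have h2 := ((contDiff_cutoff n (k := 0)).continuous.tendsto 0).comp h1
  rw [cutoff_zero] at h2
  exact h2

theorem tendsto_truncate (f : (Fin n → ℝ) → ℝ) (x : Fin n → ℝ) :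
    Tendsto (fun k => truncate f k x) atTop (𝓝 (f x)) := by
  simpa [truncate] using (tendsto_cutoff x).mul_const (f x)

theorem fderiv_truncate (hf : Differentiable ℝ f) (k : ℕ) (x v : Fin n → ℝ) :
    fderiv ℝ (truncate f k) x v = cutoff n ((1 / ((k : ℝ) + 1)) • x) * fderiv ℝ f x v
      + (1 / ((k : ℝ) + 1)) * fderiv ℝ (cutoff n) ((1 / ((k : ℝ) + 1)) • x) v * f x := by
  have h1 : HasFDerivAt (fun x : Fin n → ℝ => cutoff n ((1 / ((k : ℝ) + 1)) • x))
      ((fderiv ℝ (cutoff n) ((1 / ((k : ℝ) + 1)) • x)).comp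
        ((1 / ((k : ℝ) + 1)) • ContinuousLinearMap.id ℝ (Fin n → ℝ))) x :=
    HasFDerivAt.comp x (differentiable_cutoff n _).hasFDerivAt
      ((1 / ((k : ℝ) + 1)) • ContinuousLinearMap.id ℝ (Fin n → ℝ)).hasFDerivAt
  have h2 := (h1.mul (hf x).hasFDerivAt).fderiv
  change fderiv ℝ (fun x => cutoff n ((1 / ((k : ℝ) + 1)) • x) * f x) x v = _
  erw [h2]
  simp
  ring

/-- The derivative of the rescaled cutoff carries the factor `1 / (k + 1) ≤ 1`, so the bound is
uniform in `k` and can serve as a dominating function. -/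
theorem exists_fderiv_truncate_bound (n : ℕ) : ∃ C : ℝ, 0 ≤ C ∧
    ∀ f : (Fin n → ℝ) → ℝ, Differentiable ℝ f → ∀ k x v,
    ‖fderiv ℝ (truncate f k) x v - fderiv ℝ f x v‖ ≤ ‖fderiv ℝ f x v‖ + C * ‖v‖ * ‖f x‖ := by
  obtain ⟨C, hC, hb⟩ := exists_fderiv_cutoff_bound n
  refine ⟨C, hC, fun f hf k x v => ?_⟩
  rw [fderiv_truncate hf, add_sub_right_comm]
  refine (norm_add_le _ _).trans (add_le_add (abs_truncate_sub_le (fun x => fderiv ℝ f x v) k x) ?_)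
  rw [norm_mul, norm_mul]
  refine mul_le_mul_of_nonneg_right ?_ (norm_nonneg _)
  have h1 : ‖1 / ((k : ℝ) + 1)‖ ≤ 1 := by
    rw [Real.norm_of_nonneg (by positivity)]
    rw [div_le_one (by positivity)]
    linarith [(Nat.cast_nonneg k : (0 : ℝ) ≤ k)]
  calc _ ≤ 1 * (C * ‖v‖) := by
        refine mul_le_mul h1 ?_ (norm_nonneg _) zero_le_one
        exact (ContinuousLinearMap.le_opNorm _ _).trans (by gcongr; exact hb _)
    _ = C * ‖v‖ := one_mul _

theorem tendsto_fderiv_truncate (hf : Differentiable ℝ f) (x v : Fin n → ℝ) :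
    Tendsto (fun k => fderiv ℝ (truncate f k) x v) atTop (𝓝 (fderiv ℝ f x v)) := by
  obtain ⟨C, hC, hb⟩ := exists_fderiv_cutoff_bound n
  simp only [fderiv_truncate hf]
  have h1 : Tendsto (fun k : ℕ => (1 / ((k : ℝ) + 1)) *
      fderiv ℝ (cutoff n) ((1 / ((k : ℝ) + 1)) • x) v) atTop (𝓝 0) := by
    refine tendsto_one_div_add_atTop_nhds_zero_nat.zero_mul_isBoundedUnder_le ?_
    refine isBoundedUnder_of ⟨C * ‖v‖, fun k => ?_⟩
    exact (ContinuousLinearMap.le_opNorm _ _).trans (by gcongr; exact hb _)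
  simpa using ((tendsto_cutoff x).mul_const _).add (h1.mul_const (f x))

attribute [irreducible] truncate cutoff

end Deterministic

variable {Ω : Type*} {H : Type*} [NormedAddCommGroup H] [InnerProductSpace ℝ H] {X : H → Ω → ℝ}
  [MeasurableSpace Ω] {μ : Measure Ω}

/-- The graph of the derivative on smooth variables of temperate growth. -/
def smoothGraph (X : H → Ω → ℝ) (μ : Measure Ω) : Submodule ℝ (Lp ℝ 2 μ × Lp H 2 μ) where
  carrier := {p | ∃ F U, SmoothPair X F U ∧ (p.1 : Ω → ℝ) =ᵐ[μ] F ∧ (p.2 : Ω → H) =ᵐ[μ] U}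
  add_mem' := by
    rintro p q ⟨F, U, h, h1, h2⟩ ⟨G, V, h', h1', h2'⟩
    exact ⟨F + G, U + V, h.add h', (Lp.coeFn_add _ _).trans (h1.add h1'),
      (Lp.coeFn_add _ _).trans (h2.add h2')⟩
  zero_mem' := ⟨_, _, SmoothPair.const X 0, Lp.coeFn_zero _ _ _, Lp.coeFn_zero _ _ _⟩
  smul_mem' := by
    rintro c p ⟨F, U, h, h1, h2⟩
    exact ⟨c • F, c • U, h.const_smul c, (Lp.coeFn_smul _ _).trans (h1.const_smul c),
      (Lp.coeFn_smul _ _).trans (h2.const_smul c)⟩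

theorem cylindricalGraph_subset_smoothGraph :
    cylindricalGraph X μ ⊆ (smoothGraph X μ : Set (Lp ℝ 2 μ × Lp H 2 μ)) := by
  rintro p ⟨n, φ, f, hf, hc, h1, h2⟩
  exact ⟨_, _, ⟨n, φ, f, hc.hasTemperateGrowth hf, rfl, rfl⟩, h1, h2⟩

/-- Cutting off and passing to the limit by dominated convergence. Polynomials of the process, which
lack compact support, thereby become legitimate elements of the domain. -/
theorem smoothGraph_subset_derivGraph (hX : IsIsonormal X μ) :
    (smoothGraph X μ : Set (Lp ℝ 2 μ × Lp H 2 μ)) ⊆ derivGraph X μ := by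
  rintro ⟨p, q⟩ ⟨F, U, ⟨n, φ, f, hf, hF, hU⟩, h1, h2⟩
  have hdf : Differentiable ℝ f := hf.1.differentiable (by simp)
  have hsm : ∀ k, SmoothPair X (fun ω => truncate f k (fun i => X (φ i) ω))
      (fun ω => ∑ i, (fderiv ℝ (truncate f k) (fun j => X (φ j) ω) (Pi.single i 1)) • φ i) :=
    fun k => ⟨n, φ, _, (hasCompactSupport_truncate f k).hasTemperateGrowth
      (contDiff_truncate hf.1 k), rfl, rfl⟩
  have hs0 : SmoothPair X (fun ω => f (fun i => X (φ i) ω))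
      (fun ω => ∑ i, (fderiv ℝ f (fun j => X (φ j) ω) (Pi.single i 1)) • φ i) :=
    ⟨n, φ, f, hf, rfl, rfl⟩
  have m1 := fun k => (hsm k).memLp_fst hX (p := 2) (by simp)
  have m2 := fun k => (hsm k).memLp_snd hX (p := 2) (by simp)
  have m01 := hs0.memLp_fst hX (p := 2) (by simp)
  have m02 := hs0.memLp_snd hX (p := 2) (by simp)
  have hp : p = m01.toLp _ := Lp.ext ((h1.trans (by rw [hF])).trans m01.coeFn_toLp.symm)
  have hq : q = m02.toLp _ := Lp.ext ((h2.trans (by rw [hU])).trans m02.coeFn_toLp.symm)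
  rw [hp, hq]
  obtain ⟨C, hC, hb⟩ := exists_fderiv_truncate_bound n
  have hmem : ∀ k, ((m1 k).toLp _, (m2 k).toLp _) ∈ derivGraph X μ := fun k =>
    subset_closure ⟨n, φ, truncate f k, contDiff_truncate hf.1 k, hasCompactSupport_truncate f k,
      (m1 k).coeFn_toLp, (m2 k).coeFn_toLp⟩
  have hc : MemLp (fun ω => ∑ i, (‖fderiv ℝ f (fun j => X (φ j) ω) (Pi.single i 1)‖ +
      C * ‖(Pi.single i 1 : Fin n → ℝ)‖ * ‖f (fun i => X (φ i) ω)‖) * ‖φ i‖) 2 μ := by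
    refine memLp_finsetSum _ fun i _ => ?_
    have h1 : MemLp (fun ω => fderiv ℝ f (fun j => X (φ j) ω) (Pi.single i 1)) 2 μ :=
      (hf.fderiv_apply (Pi.single i 1)).memLp_comp (hX.hasGaussianLaw_vec φ) (by simp)
    have h2 := m01.norm.const_mul (C * ‖(Pi.single i 1 : Fin n → ℝ)‖)
    exact (h1.norm.add h2).mul_const ‖φ i‖
  refine toLp_mem_of_dominated isClosed_closure m1 m2 m01 m02 m01.norm hc
    (fun k => .of_forall fun ω => abs_truncate_sub_le f k _) (fun k => .of_forall fun ω => ?_)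
    (.of_forall fun ω => tendsto_truncate f _) (.of_forall fun ω => ?_) hmem
  · rw [← Finset.sum_sub_distrib]
    refine (norm_sum_le _ _).trans (Finset.sum_le_sum fun i _ => ?_)
    rw [← sub_smul, norm_smul]
    exact mul_le_mul_of_nonneg_right (hb f hdf _ _ _) (norm_nonneg _)
  · exact tendsto_finsetSum _ fun i _ => (tendsto_fderiv_truncate hdf _ _).smul_const _

theorem derivGraph_eq (hX : IsIsonormal X μ) :
    derivGraph X μ = ((smoothGraph X μ).topologicalClosure : Set (Lp ℝ 2 μ × Lp H 2 μ)) := by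
  rw [Submodule.topologicalClosure_coe]
  refine subset_antisymm (closure_mono cylindricalGraph_subset_smoothGraph)
    (closure_minimal (smoothGraph_subset_derivGraph hX) isClosed_closure)

/-- A closed condition that holds for smooth variables holds on the graph of the derivative. -/
theorem derivGraph_subset {s : Set (Lp ℝ 2 μ × Lp H 2 μ)} (hs : IsClosed s)
    (h : (smoothGraph X μ : Set (Lp ℝ 2 μ × Lp H 2 μ)) ⊆ s) : derivGraph X μ ⊆ s :=
  closure_minimal (cylindricalGraph_subset_smoothGraph.trans h) hs

/-- Closability. Each smooth gradient has a divergence `δ`, so its product with `w` equals that of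
`δ` with `0`. Since `w` is itself a limit of gradients, it is orthogonal to itself. -/
theorem eq_zero_of_mem_derivGraph (hX : IsIsonormal X μ) [IsProbabilityMeasure μ] {w : Lp H 2 μ}
    (hw : ((0 : Lp ℝ 2 μ), w) ∈ derivGraph X μ) : w = 0 := by
  have h1 : ∀ p ∈ smoothGraph X μ, inner ℝ p.2 w = 0 := by
    rintro ⟨F', U'⟩ ⟨F, U, hF, h1, h2⟩
    obtain ⟨δ, hδ, hd⟩ := hF.exists_divergence hX
    have hs : derivGraph X μ ⊆ {p | inner ℝ U' p.2 = inner ℝ (hδ.toLp δ) p.1} := by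
      refine derivGraph_subset (isClosed_eq (by fun_prop) (by fun_prop)) ?_
      rintro ⟨G', V'⟩ ⟨G, V, hG, h3, h4⟩
      change inner ℝ U' V' = inner ℝ (hδ.toLp δ) G'
      rw [L2.inner_def, L2.inner_def]
      have e1 : ∫ ω, inner ℝ (U' ω) (V' ω) ∂μ = ∫ ω, inner ℝ (U ω) (V ω) ∂μ :=
        integral_congr_ae (by filter_upwards [h2, h4] with ω a b; rw [a, b])
      rw [e1, hd G V hG]
      refine integral_congr_ae ?_
      filter_upwards [h3, hδ.coeFn_toLp] with ω a b
      rw [a, b]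
      simp [mul_comm]
    have := hs hw
    simpa using this
  have hs : derivGraph X μ ⊆ {p | inner ℝ p.2 w = 0} :=
    derivGraph_subset (isClosed_eq (by fun_prop) (by fun_prop)) h1
  exact inner_self_eq_zero.1 (hs hw)

theorem deriv_eq (hX : IsIsonormal X μ) [IsProbabilityMeasure μ] {Z : Lp ℝ 2 μ} {u : Lp H 2 μ}
    (h : (Z, u) ∈ derivGraph X μ) : deriv X μ Z = u := by
  have hex : ∃ u : Lp H 2 μ, (Z, u) ∈ derivGraph X μ := ⟨u, h⟩
  rw [deriv, dif_pos hex]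
  have h' := hex.choose_spec
  rw [← sub_eq_zero]
  refine eq_zero_of_mem_derivGraph hX ?_
  generalize hex.choose = u' at h' ⊢
  rw [derivGraph_eq hX] at h h' ⊢
  have := Submodule.sub_mem _ h' h
  rwa [Prod.mk_sub_mk, sub_self] at this

end Malliavin

/-! ### Totality of the Wiener chaoses. -/

/-- If the Fourier transform of the signed measure `R μ` pushed forward by `V` vanishes, then
`R` is orthogonal to the bounded continuous functions of `V`. -/
theorem MeasureTheory.integral_mul_comp_eq_zero_of_charFunDual {Ω E : Type*} [MeasurableSpace Ω]
    {μ : Measure Ω} [NormedAddCommGroup E] [NormedSpace ℝ E] [MeasurableSpace E] [BorelSpace E]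
    [CompleteSpace E] [SecondCountableTopology E] {V : Ω → E} (hV : AEMeasurable V μ) {R : Ω → ℝ}
    (hR : Measurable R) (hRi : Integrable R μ)
    (h : ∀ L : StrongDual ℝ E, ∫ ω, (R ω : ℂ) * Complex.exp (L (V ω) * Complex.I) ∂μ = 0)
    {f : E → ℝ} (hf : Continuous f) {C : ℝ} (hb : ∀ x, ‖f x‖ ≤ C) :
    ∫ ω, R ω * f (V ω) ∂μ = 0 := by
  have hfin : ∀ S : Ω → ℝ, Integrable S μ →
      IsFiniteMeasure (μ.withDensity fun ω => ((S ω).toNNReal : ENNReal)) := fun S hS =>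
    isFiniteMeasure_withDensity_ofReal hS.2
  have hsplit : ∀ a : ℝ, a = (a.toNNReal : ℝ) - ((-a).toNNReal : ℝ) := by
    intro a
    rcases le_total 0 a with ha | ha
    · rw [Real.coe_toNNReal _ ha, Real.toNNReal_of_nonpos (by linarith)]; simp
    · rw [Real.coe_toNNReal (-a) (by linarith), Real.toNNReal_of_nonpos ha]; simp
  have hmR : Measurable fun ω => (R ω).toNNReal := hR.real_toNNReal
  have hmR' : Measurable fun ω => (-R ω).toNNReal := hR.neg.real_toNNReal
  have := hfin R hRi
  have := hfin (fun ω => -R ω) hRi.neg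
  -- The positive and negative parts of the signed measure `R μ`: their images under `V` are finite
  -- measures with the same characteristic function, hence equal.
  set P := μ.withDensity fun ω => ((R ω).toNNReal : ENNReal) with hP
  set N := μ.withDensity fun ω => ((-R ω).toNNReal : ENNReal) with hN
  have hVP : AEMeasurable V P := hV.mono_ac (withDensity_absolutelyContinuous _ _)
  have hVN : AEMeasurable V N := hV.mono_ac (withDensity_absolutelyContinuous _ _)
  have hi1 : Integrable (fun ω => ((R ω).toNNReal : ℝ)) μ := hRi.real_toNNReal
  have hi2 : Integrable (fun ω => ((-R ω).toNNReal : ℝ)) μ := hRi.neg.real_toNNReal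
  have hint : ∀ {G : Type} [NormedAddCommGroup G] [NormedSpace ℝ G] (S : Ω → NNReal) (c : E → G)
      (D : ℝ), Integrable (fun ω => (S ω : ℝ)) μ → Continuous c → (∀ x, ‖c x‖ ≤ D) →
      Integrable (fun ω => S ω • c (V ω)) μ := by
    intro G _ _ S c D hS hc hD
    refine (hS.mul_const D).mono' (hS.1.smul
      (hc.comp_aestronglyMeasurable hV.aestronglyMeasurable)) (.of_forall fun ω => ?_)
    rw [NNReal.smul_def, norm_smul, Real.norm_of_nonneg (NNReal.coe_nonneg _)]
    exact mul_le_mul_of_nonneg_left (hD _) (NNReal.coe_nonneg _)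
  have key : P.map V = N.map V := by
    refine Measure.ext_of_charFunDual (funext fun L => ?_)
    have hc : Continuous fun x : E => Complex.exp (L x * Complex.I) := by fun_prop
    rw [charFunDual_apply, charFunDual_apply, integral_map hVP hc.aestronglyMeasurable,
      integral_map hVN hc.aestronglyMeasurable, hP, hN,
      integral_withDensity_eq_integral_smul hmR, integral_withDensity_eq_integral_smul hmR',
      ← sub_eq_zero, ← integral_sub, ← h L]
    · congr 1
      ext ω
      rw [NNReal.smul_def, NNReal.smul_def, ← sub_smul, ← hsplit, Complex.real_smul]
    · exact hint _ _ 1 hi1 hc fun x => (Complex.norm_exp_ofReal_mul_I _).le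
    · exact hint _ _ 1 hi2 hc fun x => (Complex.norm_exp_ofReal_mul_I _).le
  have e := congrArg (fun ν => ∫ x, f x ∂ν) key
  rw [integral_map hVP hf.aestronglyMeasurable, integral_map hVN hf.aestronglyMeasurable, hP, hN,
      integral_withDensity_eq_integral_smul hmR, integral_withDensity_eq_integral_smul hmR',
      ← sub_eq_zero, ← integral_sub] at e
  · rw [← e]
    congr 1
    ext ω
    rw [NNReal.smul_def, NNReal.smul_def, ← sub_smul, ← hsplit, smul_eq_mul]
  · exact hint _ _ C hi1 hf hb
  · exact hint _ _ C hi2 hf hb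

namespace Malliavin

variable {Ω : Type*} {H : Type*} [NormedAddCommGroup H] [InnerProductSpace ℝ H] {X : H → Ω → ℝ}
  [MeasurableSpace Ω] {μ : Measure Ω}

/-- An isonormal process is linear in its parameter. -/
theorem IsIsonormal.eval_sum_ae (hX : IsIsonormal X μ) {n : ℕ} (φ : Fin n → H) (t : Fin n → ℝ) :
    X (∑ i, t i • φ i) =ᵐ[μ] fun ω => ∑ i, t i * X (φ i) ω := by
  set l : H → Lp ℝ 2 μ := fun h => (hX.memLp h (p := 2) (by simp)).toLp (X h) with hl
  have hin : ∀ h k, inner ℝ (l h) (l k) = inner ℝ h k := by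
    intro h k
    rw [← hX.covariance h k, L2.inner_def]
    refine integral_congr_ae ?_
    filter_upwards [(hX.memLp h (p := 2) (by simp)).coeFn_toLp,
      (hX.memLp k (p := 2) (by simp)).coeFn_toLp] with ω h1 h2
    simp only [hl]
    rw [h1, h2]
    simp [mul_comm]
  -- The map `l` preserves inner products, so the defect of linearity is orthogonal to the range of
  -- `l`, which spans it; its norm is therefore zero.
  have h0 : ∀ k, inner ℝ (l k) (l (∑ i, t i • φ i) - ∑ i, t i • l (φ i)) = 0 := by
    intro k
    simp [inner_sub_right, inner_sum, inner_smul_right, hin]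
  have h1 : l (∑ i, t i • φ i) - ∑ i, t i • l (φ i) = 0 := by
    rw [← inner_self_eq_zero (𝕜 := ℝ)]
    conv_lhs => rw [inner_sub_left, sum_inner]
    simp [inner_smul_left, h0]
  have h2 : l (∑ i, t i • φ i) = ∑ i, t i • l (φ i) := sub_eq_zero.1 h1
  have h3 : (l (∑ i, t i • φ i) : Ω → ℝ) =ᵐ[μ] X (∑ i, t i • φ i) := MemLp.coeFn_toLp _
  have h4 : ((∑ i, t i • l (φ i) : Lp ℝ 2 μ) : Ω → ℝ) =ᵐ[μ] fun ω => ∑ i, t i * X (φ i) ω := by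
    refine (Lp.coeFn_finsetSum _ _).trans ?_
    have : ∀ᵐ ω ∂μ, ∀ i, (t i • l (φ i) : Lp ℝ 2 μ) ω = t i * X (φ i) ω := by
      rw [ae_all_iff]
      intro i
      filter_upwards [Lp.coeFn_smul (t i) (l (φ i)),
        (hX.memLp (φ i) (p := 2) (by simp)).coeFn_toLp] with ω a b
      rw [a, Pi.smul_apply, smul_eq_mul]
      simp only [hl]
      rw [b]
    filter_upwards [this] with ω hω
    simp [hω]
  rw [h2] at h3
  exact h3.symm.trans h4

theorem IsIsonormal.integrable_exp_abs (hX : IsIsonormal X μ) [IsProbabilityMeasure μ] (h : H)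
    (t : ℝ) : Integrable (fun ω => Real.exp (|t| * |X h ω|)) μ := by
  have : ∀ s : ℝ, Integrable (fun ω => Real.exp (s * X h ω)) μ := by
    intro s
    have h1 := integrable_exp_mul_gaussianReal (μ := 0) (v := ‖h‖₊ ^ 2) s
    rw [← hX.map_eq_gaussianReal h,
      integrable_map_measure (by fun_prop) (hX.gaussian.aemeasurable h)] at h1
    exact h1
  exact integrable_exp_abs_mul_abs (this t) (this (-t))

/-- The variable `Heₘ(X(h))` as an element of `L²`. -/
def hermiteVar (hX : IsIsonormal X μ) (m : ℕ) (h : H) : Lp ℝ 2 μ :=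
  ((SmoothPair.aeval X h (Polynomial.hermite m)).memLp_fst hX (p := 2) (by simp)).toLp _

theorem hermiteVar_mem_chaos (hX : IsIsonormal X μ) {m : ℕ} {h : H} (hm : m = 0 ∨ ‖h‖ = 1) :
    hermiteVar hX m h ∈ chaos X μ m :=
  Submodule.le_topologicalClosure _ (Submodule.subset_span ⟨h, hm, MemLp.coeFn_toLp _⟩)

theorem integrable_mul_pow (hX : IsIsonormal X μ) (R : Lp ℝ 2 μ) (h : H) (k : ℕ) :
    Integrable (fun ω => R ω * X h ω ^ k) μ := by
  have h1 := ((SmoothPair.aeval X h (Polynomial.X ^ k)).memLp_fst hX (p := 2) (by simp))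
  refine ((Lp.memLp R).integrable_mul h1).congr (.of_forall fun ω => ?_)
  simp

/-- The `k`-th Hermite polynomial is monic of degree `k`, so orthogonality to it and to the lower
powers forces orthogonality to the `k`-th power. -/
theorem integral_mul_pow_eq_zero (hX : IsIsonormal X μ) {R : Lp ℝ 2 μ}
    (hR : ∀ m, ∀ F ∈ chaos X μ m, inner ℝ F R = 0) {h : H} (hh : ‖h‖ = 1) (k : ℕ) :
    ∫ ω, R ω * X h ω ^ k ∂μ = 0 := by
  induction k using Nat.strong_induction_on with
  | _ k ih =>
    have h1 := hR k _ (hermiteVar_mem_chaos hX (m := k) (.inr hh))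
    have h2 : inner ℝ (hermiteVar hX k h) R = ∫ ω, (∑ i ∈ Finset.range (k + 1),
        ((Polynomial.hermite k).coeff i : ℝ) * (R ω * X h ω ^ i)) ∂μ := by
      rw [L2.inner_def]
      refine integral_congr_ae ?_
      have hc : (hermiteVar hX k h : Ω → ℝ) =ᵐ[μ]
        fun ω => Polynomial.aeval (X h ω) (Polynomial.hermite k) := MemLp.coeFn_toLp _
      filter_upwards [hc] with ω hω
      rw [hω, Polynomial.aeval_eq_sum_range, Polynomial.natDegree_hermite]
      simp only [RCLike.inner_apply, conj_trivial, Finset.mul_sum]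
      refine Finset.sum_congr rfl fun i _ => ?_
      rw [zsmul_eq_mul]; ring
    rw [h1, integral_finsetSum _ fun i _ => (integrable_mul_pow hX R h i).const_mul _] at h2
    simp only [integral_const_mul] at h2
    rw [Finset.sum_range_succ, Finset.sum_eq_zero fun i hi => by
      rw [ih i (Finset.mem_range.1 hi), mul_zero]] at h2
    simpa [Polynomial.coeff_hermite_self] using h2.symm

/-- The exponential series is integrated term by term; the partial sums are dominated by `|R|
exp(|t| |X h|)`, a product of two square-integrable functions. -/
theorem integral_mul_exp_eq_zero_of_norm (hX : IsIsonormal X μ) [IsProbabilityMeasure μ]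
    {R : Lp ℝ 2 μ} (hR : ∀ m, ∀ F ∈ chaos X μ m, inner ℝ F R = 0) {h : H} (hh : ‖h‖ = 1) (t : ℝ) :
    ∫ ω, (R ω : ℂ) * Complex.exp ((t * X h ω : ℝ) * Complex.I) ∂μ = 0 := by
  have hXm : AEStronglyMeasurable (X h) μ := (hX.gaussian.aemeasurable h).aestronglyMeasurable
  have hRm : AEStronglyMeasurable R μ := Lp.aestronglyMeasurable R
  have hs := hasSum_integral_of_dominated_convergence (μ := μ)
    (F := fun (n : ℕ) ω => (R ω : ℂ) * (((t * X h ω : ℝ) * Complex.I) ^ n / n.factorial))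
    (f := fun ω => (R ω : ℂ) * Complex.exp ((t * X h ω : ℝ) * Complex.I))
    (fun n ω => ‖R ω‖ * ((|t| * |X h ω|) ^ n / n.factorial))
    (fun n => by
      refine (Complex.continuous_ofReal.comp_aestronglyMeasurable hRm).mul ?_
      have hc : Continuous fun x : ℝ => ((t * x : ℝ) * Complex.I) ^ n / (n.factorial : ℂ) := by
        fun_prop
      exact hc.comp_aestronglyMeasurable hXm)
    (fun n => .of_forall fun ω => by simp)
    (.of_forall fun ω => ((Real.summable_pow_div_factorial _).mul_left _))
    (by
      have he : ∀ x : ℝ, ∑' n : ℕ, x ^ n / n.factorial = Real.exp x := fun x => by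
        rw [Real.exp_eq_exp_ℝ, NormedSpace.exp_eq_tsum_div]
      simp only [tsum_mul_left, he]
      have h2 : MemLp (fun ω => Real.exp (|t| * |X h ω|)) 2 μ := by
        rw [memLp_two_iff_integrable_sq]
        · have := hX.integrable_exp_abs h (2 * t)
          refine this.congr (.of_forall fun ω => ?_)
          simp only [abs_mul, ← Real.exp_nat_mul]
          congr 1
          simp; ring
        · exact (by fun_prop : Continuous fun x : ℝ =>
            Real.exp (|t| * |x|)).comp_aestronglyMeasurable hXm
      exact (Lp.memLp R).norm.integrable_mul h2)
    (.of_forall fun ω => by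
      refine HasSum.mul_left _ ?_
      have := NormedSpace.expSeries_div_hasSum_exp (𝔸 := ℂ) ((t * X h ω : ℝ) * Complex.I)
      rwa [← Complex.exp_eq_exp_ℂ] at this)
  have h0 : ∀ n : ℕ, ∫ ω, (R ω : ℂ) * (((t * X h ω : ℝ) * Complex.I) ^ n / n.factorial) ∂μ = 0 := by
    intro n
    have : ∀ ω, (R ω : ℂ) * (((t * X h ω : ℝ) * Complex.I) ^ n / n.factorial)
        = ((t * Complex.I) ^ n / n.factorial) * ((R ω * X h ω ^ n : ℝ) : ℂ) := by
      intro ω; push_cast; ring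
    simp only [this]
    rw [integral_const_mul, integral_complex_ofReal, integral_mul_pow_eq_zero hX hR hh]
    simp
  simp only [h0] at hs
  exact hs.unique hasSum_zero

theorem integral_mul_exp_eq_zero (hX : IsIsonormal X μ) [IsProbabilityMeasure μ]
    {R : Lp ℝ 2 μ} (hR : ∀ m, ∀ F ∈ chaos X μ m, inner ℝ F R = 0) (h : H) :
    ∫ ω, (R ω : ℂ) * Complex.exp (X h ω * Complex.I) ∂μ = 0 := by
  by_cases h0 : h = 0
  · subst h0
    have h1 := hR 0 _ (hermiteVar_mem_chaos hX (m := 0) (h := 0) (.inl rfl))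
    have h2 : inner ℝ (hermiteVar hX 0 0) R = ∫ ω, R ω ∂μ := by
      rw [L2.inner_def]
      refine integral_congr_ae ?_
      have hc : (hermiteVar hX 0 0 : Ω → ℝ) =ᵐ[μ]
        fun ω => Polynomial.aeval (X 0 ω) (Polynomial.hermite 0) := MemLp.coeFn_toLp _
      filter_upwards [hc] with ω hω
      rw [hω]
      simp
    rw [h1] at h2
    have h3 : ∫ ω, (R ω : ℂ) * Complex.exp (X 0 ω * Complex.I) ∂μ = ∫ ω, (R ω : ℂ) ∂μ :=
      integral_congr_ae (by filter_upwards [hX.zero_ae] with ω hω; simp [hω])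
    rw [h3, integral_complex_ofReal, ← h2]
    simp
  have hn : ‖h‖ ≠ 0 := norm_ne_zero_iff.2 h0
  have h1 : ‖‖h‖⁻¹ • h‖ = 1 := by rw [norm_smul, norm_inv, norm_norm, inv_mul_cancel₀ hn]
  rw [← integral_mul_exp_eq_zero_of_norm hX hR h1 ‖h‖]
  refine integral_congr_ae ?_
  have h2 := hX.eval_sum_ae (fun _ : Fin 1 => ‖h‖⁻¹ • h) (fun _ => ‖h‖)
  simp only [Finset.univ_unique, Finset.sum_singleton, smul_smul, mul_inv_cancel₀ hn,
    one_smul] at h2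
  filter_upwards [h2] with ω hω
  rw [hω]

/-- The Wiener chaoses are total in the closed span of the cylindrical variables. -/
theorem inner_eq_zero_of_forall_chaos (hX : IsIsonormal X μ) [IsProbabilityMeasure μ]
    {R : Lp ℝ 2 μ} (hR : ∀ m, ∀ F ∈ chaos X μ m, inner ℝ F R = 0) {p : Lp ℝ 2 μ × Lp H 2 μ}
    (hp : p ∈ derivGraph X μ) : inner ℝ p.1 R = 0 := by
  have hs : derivGraph X μ ⊆ {p | inner ℝ p.1 R = 0} := by
    refine closure_minimal ?_ (isClosed_eq (by fun_prop) (by fun_prop))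
    rintro ⟨F, U⟩ ⟨n, φ, f, hf, hc, h1, -⟩
    change inner ℝ F R = 0
    obtain ⟨C, hC⟩ := hf.continuous.bounded_above_of_compact_support hc
    rw [L2.inner_def]
    have := integral_mul_comp_eq_zero_of_charFunDual (hX.hasGaussianLaw_vec φ).aemeasurable
      (Lp.stronglyMeasurable R).measurable ((Lp.memLp R).integrable (by simp)) (fun L => by
        -- By linearity of the process, a functional `L` of the Gaussian vector is a single variable
        -- of the process, up to a null set.
        rw [← integral_mul_exp_eq_zero hX hR (∑ i, L (Pi.single i 1) • φ i)]
        refine integral_congr_ae ?_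
        filter_upwards [hX.eval_sum_ae φ fun i => L (Pi.single i 1)] with ω hω
        rw [hω, L.apply_eq_sum_single]
        simp only [mul_comm]) hf.continuous hC
    rw [← this]
    refine integral_congr_ae ?_
    filter_upwards [h1] with ω hω
    rw [hω]
    simp
  exact hs hp

end Malliavin

/-! ### Orthogonal families of projections in a Hilbert space. -/

section Orthogonal

variable {E : Type*} [NormedAddCommGroup E] [InnerProductSpace ℝ E]

theorem summable_of_pairwise_inner_eq_zero [CompleteSpace E] {ι : Type*} {v : ι → E}
    (hv : Pairwise fun i j => inner ℝ (v i) (v j) = 0) (hs : Summable fun i => ‖v i‖ ^ 2) :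
    Summable v := by
  have ho : OrthogonalFamily ℝ (fun i => (Submodule.span ℝ {v i} : Submodule ℝ E))
      fun i => (Submodule.span ℝ {v i}).subtypeₗᵢ :=
    OrthogonalFamily.of_pairwise fun i j hij => by
      simpa [Function.onFun, Submodule.isOrtho_span] using hv hij
  exact (ho.summable_iff_norm_sq_summable
    fun i => ⟨v i, Submodule.mem_span_singleton_self _⟩).2 hs

variable {V : ℕ → Submodule ℝ E} [∀ m, (V m).HasOrthogonalProjection]

theorem inner_starProjection_eq (m : ℕ) {F : E} (hF : F ∈ V m) (Z : E) :
    inner ℝ F ((V m).starProjection Z) = inner ℝ F Z := by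
  have := Submodule.starProjection_inner_eq_zero (K := V m) Z F hF
  rw [inner_sub_left, sub_eq_zero] at this
  rw [real_inner_comm, ← this, real_inner_comm]

/-- Bessel's inequality: a partial sum `S` satisfies `‖S‖ ^ 2 = ⟨S, Z⟩`, hence `‖S‖ ≤ ‖Z‖`. -/
theorem summable_norm_sq_starProjection
    (hV : ∀ m n, m ≠ n → ∀ F ∈ V m, ∀ G ∈ V n, inner ℝ F G = 0) (Z : E) :
    Summable fun m => ‖(V m).starProjection Z‖ ^ 2 := by
  have hmem : ∀ m, (V m).starProjection Z ∈ V m := fun m => Submodule.starProjection_apply_mem _ _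
  refine summable_of_sum_le (c := ‖Z‖ ^ 2) (fun _ => sq_nonneg _) fun s => ?_
  set S := ∑ m ∈ s, (V m).starProjection Z with hS
  have h1 : inner ℝ S Z = ∑ m ∈ s, ‖(V m).starProjection Z‖ ^ 2 := by
    rw [hS, sum_inner]
    refine Finset.sum_congr rfl fun m _ => ?_
    rw [← inner_starProjection_eq m (hmem m) Z, real_inner_self_eq_norm_sq]
  have h2 : inner ℝ S S = ∑ m ∈ s, ‖(V m).starProjection Z‖ ^ 2 := by
    conv_lhs => rw [hS, sum_inner]
    refine Finset.sum_congr rfl fun m hm => ?_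
    rw [inner_sum, Finset.sum_eq_single m, real_inner_self_eq_norm_sq]
    · exact fun n _ hn => hV m n hn.symm _ (hmem m) _ (hmem n)
    · exact fun h => absurd hm h
  rw [← h2, real_inner_self_eq_norm_sq]
  have h3 : ‖S‖ ^ 2 ≤ ‖S‖ * ‖Z‖ := by
    rw [← real_inner_self_eq_norm_sq, h2, ← h1]
    exact real_inner_le_norm _ _
  nlinarith [norm_nonneg S, norm_nonneg Z, sq_nonneg (‖S‖ - ‖Z‖)]

theorem summable_starProjection [CompleteSpace E]
    (hV : ∀ m n, m ≠ n → ∀ F ∈ V m, ∀ G ∈ V n, inner ℝ F G = 0) (Z : E) :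
    Summable fun m => (V m).starProjection Z :=
  summable_of_pairwise_inner_eq_zero (fun m n hmn => hV m n hmn _
    (Submodule.starProjection_apply_mem _ _) _ (Submodule.starProjection_apply_mem _ _))
    (summable_norm_sq_starProjection hV Z)

theorem inner_sub_tsum_starProjection [CompleteSpace E]
    (hV : ∀ m n, m ≠ n → ∀ F ∈ V m, ∀ G ∈ V n, inner ℝ F G = 0) (Z : E) (n : ℕ) {F : E}
    (hF : F ∈ V n) : inner ℝ F (Z - ∑' m, (V m).starProjection Z) = 0 := by
  have h1 : HasSum (fun m => inner ℝ F ((V m).starProjection Z))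
      (inner ℝ F (∑' m, (V m).starProjection Z)) :=
    (summable_starProjection hV Z).hasSum.mapL (innerSL ℝ F)
  have h2 := h1.unique (hasSum_single n fun m hm => hV n m hm.symm F hF _
    (Submodule.starProjection_apply_mem _ _))
  rw [inner_sub_right, h2, inner_starProjection_eq n hF, sub_self]

end Orthogonal

/-! ### Chaoses as eigenspaces, and the derivative of the pseudo-inverse. -/

namespace Malliavin

theorem chaosProj_zero_eq_zero {Ω H : Type*} [MeasurableSpace Ω] [NormedAddCommGroup H]
    {X : H → Ω → ℝ} {μ : Measure Ω} {Z : Lp ℝ 2 μ} [IsProbabilityMeasure μ]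
    (hZ : ∫ ω, Z ω ∂μ = 0) : chaosProj X μ 0 Z = 0 := by
  refine (Submodule.starProjection_apply_eq_zero_iff _).2 ?_
  rw [Submodule.mem_orthogonal']
  have : chaos X μ 0 ≤ (Submodule.span ℝ {Z})ᗮ := by
    refine Submodule.topologicalClosure_minimal _ (Submodule.span_le.2 ?_)
      (Submodule.isClosed_orthogonal _)
    rintro G ⟨h, -, hG⟩
    rw [SetLike.mem_coe, Submodule.mem_orthogonal_singleton_iff_inner_right, L2.inner_def, ← hZ]
    refine integral_congr_ae ?_
    filter_upwards [hG] with ω hω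
    rw [hω]
    simp
  intro G hG
  have := this hG
  rwa [Submodule.mem_orthogonal_singleton_iff_inner_right] at this

variable {Ω : Type*} {H : Type*} [NormedAddCommGroup H] [InnerProductSpace ℝ H] {X : H → Ω → ℝ}
  [MeasurableSpace Ω] {μ : Measure Ω}

/-- The pairs `(F, DF)` such that `F` is an eigenvector of `δD` of eigenvalue `m`, in the weak
sense. -/
def eigenGraph (X : H → Ω → ℝ) (μ : Measure Ω) (m : ℕ) : Submodule ℝ (Lp ℝ 2 μ × Lp H 2 μ) where
  carrier := {p | p ∈ (smoothGraph X μ).topologicalClosure ∧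
    ∀ q ∈ (smoothGraph X μ).topologicalClosure, inner ℝ q.2 p.2 = m * inner ℝ q.1 p.1}
  add_mem' := by
    rintro p q ⟨hp, hp'⟩ ⟨hq, hq'⟩
    exact ⟨Submodule.add_mem _ hp hq, fun r hr => by
      simp only [Prod.fst_add, Prod.snd_add, inner_add_right, hp' r hr, hq' r hr, mul_add]⟩
  zero_mem' := ⟨Submodule.zero_mem _, fun r hr => by simp⟩
  smul_mem' := by
    rintro c p ⟨hp, hp'⟩
    exact ⟨Submodule.smul_mem _ c hp, fun r hr => by
      simp only [Prod.smul_fst, Prod.smul_snd, inner_smul_right, hp' r hr]; ring⟩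

theorem isClosed_eigenGraph (m : ℕ) :
    IsClosed (eigenGraph X μ m : Set (Lp ℝ 2 μ × Lp H 2 μ)) := by
  have : (eigenGraph X μ m : Set (Lp ℝ 2 μ × Lp H 2 μ)) =
    ((smoothGraph X μ).topologicalClosure : Set (Lp ℝ 2 μ × Lp H 2 μ)) ∩
      ⋂ q ∈ (smoothGraph X μ).topologicalClosure,
        {p | inner ℝ q.2 p.2 = m * inner ℝ q.1 p.1} := by
    ext p
    simp only [Set.mem_inter_iff, Set.mem_iInter]
    rfl
  rw [this]
  refine (Submodule.isClosed_topologicalClosure _).inter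
    (isClosed_biInter fun q _ => isClosed_eq (by fun_prop) (by fun_prop))

/-- The weak eigenvalue equation tested against the pair itself. On a fixed eigenspace the norm of
the derivative is thus controlled by that of the variable. -/
theorem norm_snd_sq_of_mem_eigenGraph {m : ℕ} {p : Lp ℝ 2 μ × Lp H 2 μ}
    (hp : p ∈ eigenGraph X μ m) : ‖p.2‖ ^ 2 = m * ‖p.1‖ ^ 2 := by
  rw [← real_inner_self_eq_norm_sq, ← real_inner_self_eq_norm_sq]
  exact hp.2 p hp.1

theorem inner_snd_of_mem_eigenGraph {m n : ℕ} {p q : Lp ℝ 2 μ × Lp H 2 μ}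
    (hp : p ∈ eigenGraph X μ m) (hq : q ∈ eigenGraph X μ n) :
    inner ℝ q.2 p.2 = m * inner ℝ q.1 p.1 := hp.2 q hq.1

/-- Testing each pair against the other, symmetry gives `(m - n) ⟨F, G⟩ = 0`. -/
theorem inner_fst_eq_zero_of_mem_eigenGraph {m n : ℕ} (hmn : m ≠ n) {p q : Lp ℝ 2 μ × Lp H 2 μ}
    (hp : p ∈ eigenGraph X μ m) (hq : q ∈ eigenGraph X μ n) : inner ℝ p.1 q.1 = 0 := by
  have h1 := inner_snd_of_mem_eigenGraph hp hq
  have h2 := inner_snd_of_mem_eigenGraph hq hp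
  rw [real_inner_comm, h2, real_inner_comm] at h1
  have h3 : (m : ℝ) - n ≠ 0 := sub_ne_zero.2 (by exact_mod_cast hmn)
  rw [real_inner_comm]
  have : ((m : ℝ) - n) * inner ℝ q.1 p.1 = 0 := by linarith
  exact (mul_eq_zero.1 this).resolve_left h3

theorem hermite_mem_eigenGraph (hX : IsIsonormal X μ) [IsProbabilityMeasure μ] {m : ℕ} {h : H}
    (hm : m = 0 ∨ ‖h‖ = 1) {F : Lp ℝ 2 μ}
    (hF : (F : Ω → ℝ) =ᵐ[μ] fun ω => Polynomial.aeval (X h ω) (Polynomial.hermite m)) :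
    ∃ v, (F, v) ∈ eigenGraph X μ m := by
  have hs := SmoothPair.aeval X h (Polynomial.hermite m)
  have hm2 := hs.memLp_snd hX (p := 2) (by simp)
  refine ⟨hm2.toLp _, Submodule.le_topologicalClosure _ ⟨_, _, hs, hF, hm2.coeFn_toLp⟩, ?_⟩
  intro q hq
  have hcl : derivGraph X μ ⊆ {q | inner ℝ q.2 (hm2.toLp _) = m * inner ℝ q.1 F} := by
    refine derivGraph_subset (isClosed_eq (by fun_prop) (by fun_prop)) ?_
    rintro ⟨G', V'⟩ ⟨G, V, hG, h3, h4⟩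
    change inner ℝ V' (hm2.toLp _) = m * inner ℝ G' F
    rw [L2.inner_def, L2.inner_def]
    have e := hG.integral_inner_hermite hX m hm
    have e1 : ∫ ω, inner ℝ (V' ω) (hm2.toLp _ ω) ∂μ = ∫ ω, inner ℝ (Polynomial.aeval (X h ω)
        (Polynomial.derivative (Polynomial.hermite m)) • h) (V ω) ∂μ :=
      integral_congr_ae (by
        filter_upwards [h4, hm2.coeFn_toLp] with ω a b
        rw [a, b, real_inner_comm])
    rw [e1, e]
    congr 1
    refine integral_congr_ae ?_
    filter_upwards [h3, hF] with ω a b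
    rw [a, b]
    simp
  have := derivGraph_eq hX ▸ hcl
  exact this hq

/-- The first projection of the closed space `eigenGraph` is bounded below, so its range is closed.
That range contains the Hermite variables, hence their closed span. -/
theorem exists_mem_eigenGraph [CompleteSpace H] (hX : IsIsonormal X μ) [IsProbabilityMeasure μ]
    {m : ℕ} {F : Lp ℝ 2 μ} (hF : F ∈ chaos X μ m) : ∃ v, (F, v) ∈ eigenGraph X μ m := by
  let T : eigenGraph X μ m →ₗ[ℝ] Lp ℝ 2 μ :=
    (LinearMap.fst ℝ (Lp ℝ 2 μ) (Lp H 2 μ)).comp (eigenGraph X μ m).subtype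
  have hTa : AntilipschitzWith (1 + m) T := by
    refine AddMonoidHomClass.antilipschitz_of_bound T fun p => ?_
    have h1 := norm_snd_sq_of_mem_eigenGraph p.2
    have h0 : (0 : ℝ) ≤ m := Nat.cast_nonneg m
    change max ‖p.1.1‖ ‖p.1.2‖ ≤ ((1 + m : NNReal) : ℝ) * ‖p.1.1‖
    push_cast
    refine max_le ?_ ?_
    · nlinarith [norm_nonneg p.1.1]
    · refine abs_le_of_sq_le_sq' ?_ (by positivity) |>.2
      rw [h1, mul_pow]
      gcongr
      nlinarith
  have hcl : IsClosed (LinearMap.range T : Set (Lp ℝ 2 μ)) := by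
    have : CompleteSpace (eigenGraph X μ m) :=
      (isClosed_eigenGraph m).isComplete.completeSpace_coe
    have hu : UniformContinuous T :=
      (uniformContinuous_fst).comp uniformContinuous_subtype_val
    rw [LinearMap.coe_range]
    exact hTa.isClosed_range hu
  have hle : chaos X μ m ≤ LinearMap.range T := by
    refine Submodule.topologicalClosure_minimal _ (Submodule.span_le.2 ?_) hcl
    rintro G ⟨h, hm, hG⟩
    obtain ⟨v, hv⟩ := hermite_mem_eigenGraph hX hm hG
    exact ⟨⟨(G, v), hv⟩, rfl⟩
  obtain ⟨⟨⟨G, v⟩, hv⟩, rfl⟩ := hle hF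
  exact ⟨v, hv⟩

theorem inner_chaos_eq_zero [CompleteSpace H] (hX : IsIsonormal X μ) [IsProbabilityMeasure μ]
    {m n : ℕ} (hmn : m ≠ n) {F G : Lp ℝ 2 μ} (hF : F ∈ chaos X μ m) (hG : G ∈ chaos X μ n) :
    inner ℝ F G = 0 := by
  obtain ⟨v, hv⟩ := exists_mem_eigenGraph hX hF
  obtain ⟨w, hw⟩ := exists_mem_eigenGraph hX hG
  exact inner_fst_eq_zero_of_mem_eigenGraph hmn hv hw

/-- `-DL⁻¹Z` exists, and its divergence is `Z` when `Z` is centered. -/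
theorem invL_spec [CompleteSpace H] (hX : IsIsonormal X μ) [IsProbabilityMeasure μ]
    {Z : Lp ℝ 2 μ} (hmean : ∫ ω, Z ω ∂μ = 0)
    {q : Lp ℝ 2 μ × Lp H 2 μ} (hq : q ∈ derivGraph X μ) :
    inner ℝ q.2 (-deriv X μ (invL X μ Z)) = inner ℝ q.1 Z := by
  have hV : ∀ m n, m ≠ n → ∀ F ∈ chaos X μ m, ∀ G ∈ chaos X μ n, inner ℝ F G = 0 :=
    fun m n hmn F hF G hG => inner_chaos_eq_zero hX hmn hF hG
  have hmem : ∀ m, chaosProj X μ m Z ∈ chaos X μ m := fun m =>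
    Submodule.starProjection_apply_mem _ _
  choose v hv using fun m => exists_mem_eigenGraph hX (hmem m)
  have hsq : Summable fun m => ‖chaosProj X μ m Z‖ ^ 2 := summable_norm_sq_starProjection hV Z
  have hJ : Summable fun m => chaosProj X μ m Z := summable_starProjection hV Z
  have hsq1 := (summable_nat_add_iff 1).2 hsq
  have hJ1 := (summable_nat_add_iff 1).2 hJ
  set c : ℕ → ℝ := fun m => -(1 / ((m : ℝ) + 1)) with hc
  -- The squared norm of the `m`-th term of the derivative series is `c m ^ 2 * (m + 1)` times that
  -- of the projection, so this bound gives its convergence for every square-integrable `Z`.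
  have hc1 : ∀ m, c m ^ 2 * ((m : ℝ) + 1) ≤ 1 := fun m => by
    have : (0 : ℝ) < (m : ℝ) + 1 := by positivity
    simp only [hc]
    rw [neg_sq, div_pow, one_pow, one_div, sq, mul_inv, mul_assoc, inv_mul_cancel₀ this.ne',
      mul_one]
    exact inv_le_one_of_one_le₀ (by linarith [(Nat.cast_nonneg m : (0 : ℝ) ≤ m)])
  have hs1 : Summable fun m => c m • chaosProj X μ (m + 1) Z := by
    refine summable_of_pairwise_inner_eq_zero (fun m n hmn => ?_)
      (Summable.of_nonneg_of_le (fun _ => sq_nonneg _) (fun m => ?_) hsq1)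
    · change inner ℝ (c m • chaosProj X μ (m + 1) Z) (c n • chaosProj X μ (n + 1) Z) = 0
      rw [inner_smul_left, inner_smul_right, hV _ _ (by omega) _ (hmem _) _ (hmem _)]
      simp
    · rw [norm_smul, mul_pow, Real.norm_eq_abs, sq_abs]
      refine mul_le_of_le_one_left (sq_nonneg _) (le_trans ?_ (hc1 m))
      exact le_mul_of_one_le_right (sq_nonneg _) (by linarith [(Nat.cast_nonneg m : (0 : ℝ) ≤ m)])
  have hs2 : Summable fun m => c m • v (m + 1) := by
    refine summable_of_pairwise_inner_eq_zero (fun m n hmn => ?_)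
      (Summable.of_nonneg_of_le (fun _ => sq_nonneg _) (fun m => ?_) hsq1)
    · have := inner_snd_of_mem_eigenGraph (hv (n + 1)) (hv (m + 1))
      simp only at this
      change inner ℝ (c m • v (m + 1)) (c n • v (n + 1)) = 0
      rw [inner_smul_left, inner_smul_right, this,
        hV _ _ (by omega) _ (hmem _) _ (hmem _)]
      simp
    · have := norm_snd_sq_of_mem_eigenGraph (hv (m + 1))
      simp only at this
      rw [norm_smul, mul_pow, Real.norm_eq_abs, sq_abs, this, ← mul_assoc]
      refine mul_le_of_le_one_left (sq_nonneg _) ?_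
      push_cast
      exact hc1 m
  have hpair : (invL X μ Z, ∑' m, c m • v (m + 1)) ∈ derivGraph X μ := by
    rw [derivGraph_eq hX]
    have hsum : HasSum (fun m => ((c m • chaosProj X μ (m + 1) Z, c m • v (m + 1)) :
        Lp ℝ 2 μ × Lp H 2 μ)) (invL X μ Z, ∑' m, c m • v (m + 1)) :=
      hs1.hasSum.prodMk hs2.hasSum
    refine (Submodule.isClosed_topologicalClosure _).mem_of_tendsto hsum (.of_forall fun s => ?_)
    exact Submodule.sum_mem _ fun m _ => Submodule.smul_mem _ (c m) (hv (m + 1)).1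
  rw [deriv_eq hX hpair]
  have h1 : HasSum (fun m => inner ℝ q.2 (c m • v (m + 1)))
      (inner ℝ q.2 (∑' m, c m • v (m + 1))) := hs2.hasSum.mapL (innerSL ℝ q.2)
  -- The eigenvalue `m + 1` cancels the coefficient `-1 / (m + 1)`.
  have h2 : ∀ m, inner ℝ q.2 (c m • v (m + 1)) = -inner ℝ q.1 (chaosProj X μ (m + 1) Z) := by
    intro m
    have h3 := (hv (m + 1)).2 q (by rw [derivGraph_eq hX] at hq; exact hq)
    simp only at h3
    rw [inner_smul_right, h3]
    have : (m : ℝ) + 1 ≠ 0 := by positivity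
    simp only [hc]
    push_cast
    field_simp
  simp only [h2] at h1
  have h4 : HasSum (fun m => inner ℝ q.1 (chaosProj X μ (m + 1) Z))
      (inner ℝ q.1 (∑' m, chaosProj X μ (m + 1) Z)) := hJ1.hasSum.mapL (innerSL ℝ q.1)
  have h5 := h1.unique h4.neg
  -- Centering restores the missing term of index 0. The rest of `Z` outside the chaoses is
  -- invisible to `q.1` by totality.
  have h6 : ∑' m, chaosProj X μ (m + 1) Z = ∑' m, chaosProj X μ m Z := by
    rw [hJ.tsum_eq_zero_add, chaosProj_zero_eq_zero hmean, zero_add]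
  have h7 := inner_eq_zero_of_forall_chaos hX
    (fun m F hF => inner_sub_tsum_starProjection hV Z m hF) hq
  rw [inner_sub_right, sub_eq_zero] at h7
  rw [inner_neg_right, h5, neg_neg, h6, h7]
  rfl

end Malliavin

/-! ### Chain rule and integration by parts for the law of `Z`. -/

namespace Malliavin

variable {Ω : Type*} {H : Type*} [NormedAddCommGroup H] [InnerProductSpace ℝ H] {X : H → Ω → ℝ}

theorem SmoothPair.comp_of_hasCompactSupport {n : ℕ} (φ : Fin n → H) {F : (Fin n → ℝ) → ℝ}
    (hF : ContDiff ℝ ((⊤ : ℕ∞) : WithTop ℕ∞) F) (hc : HasCompactSupport F) {f : ℝ → ℝ}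
    (hf : ContDiff ℝ ((⊤ : ℕ∞) : WithTop ℕ∞) f) :
    SmoothPair X (fun ω => f (F fun i => X (φ i) ω)) (fun ω => _root_.deriv f
      (F fun i => X (φ i) ω) • ∑ i, (fderiv ℝ F (fun j => X (φ j) ω) (Pi.single i 1)) • φ i) := by
  have h1 : (f ∘ F).HasTemperateGrowth := by
    -- No growth condition on `f` is needed: `f ∘ F` is the constant `f 0` off a compact set.
    have h2 : HasCompactSupport ((fun y => f y - f 0) ∘ F) := hc.comp_left (by simp)
    have h3 := (h2.hasTemperateGrowth ((hf.sub contDiff_const).comp hF)).add (.const (f 0))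
    convert h3 using 1
    ext x
    simp
  refine ⟨n, φ, f ∘ F, h1, rfl, ?_⟩
  ext ω
  rw [Finset.smul_sum]
  refine Finset.sum_congr rfl fun i _ => ?_
  have hdf := (hf.differentiable (by simp) (F fun i => X (φ i) ω)).hasDerivAt
  have hdF := (hF.differentiable (by simp) (fun i => X (φ i) ω)).hasFDerivAt
  rw [(hdf.comp_hasFDerivAt _ hdF).fderiv, smul_smul]
  rfl

variable [MeasurableSpace Ω] {μ : Measure Ω} {f : ℝ → ℝ} {C : ℝ}

theorem norm_sub_le_of_norm_deriv_le (hf : ContDiff ℝ ((⊤ : ℕ∞) : WithTop ℕ∞) f)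
    (hC : ∀ x, ‖_root_.deriv f x‖ ≤ C) (x y : ℝ) : ‖f x - f y‖ ≤ C * ‖x - y‖ :=
  Convex.norm_image_sub_le_of_norm_deriv_le (fun x _ => hf.differentiable (by simp) x)
    (fun x _ => hC x) convex_univ (Set.mem_univ y) (Set.mem_univ x)

theorem continuous_deriv_of_contDiff (hf : ContDiff ℝ ((⊤ : ℕ∞) : WithTop ℕ∞) f) :
    Continuous (_root_.deriv f) := hf.continuous_deriv (by simp)

theorem memLp_comp_of_norm_deriv_le [IsFiniteMeasure μ]
    (hf : ContDiff ℝ ((⊤ : ℕ∞) : WithTop ℕ∞) f)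
    (hC : ∀ x, ‖_root_.deriv f x‖ ≤ C) (Z : Lp ℝ 2 μ) : MemLp (fun ω => f (Z ω)) 2 μ := by
  have h1 : MemLp (fun ω => C * ‖Z ω‖ + ‖f 0‖) 2 μ :=
    ((Lp.memLp Z).norm.const_mul C).add (memLp_const _)
  refine h1.mono (hf.continuous.comp_aestronglyMeasurable (Lp.aestronglyMeasurable Z))
    (.of_forall fun ω => le_trans ?_ (le_abs_self _))
  have h2 := norm_sub_le_of_norm_deriv_le hf hC (Z ω) 0
  rw [sub_zero] at h2
  linarith [norm_sub_norm_le (f (Z ω)) (f 0)]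

theorem memLp_deriv_comp_smul (hf : ContDiff ℝ ((⊤ : ℕ∞) : WithTop ℕ∞) f)
    (hC : ∀ x, ‖_root_.deriv f x‖ ≤ C) (Z : Lp ℝ 2 μ) (u : Lp H 2 μ) :
    MemLp (fun ω => _root_.deriv f (Z ω) • u ω) 2 μ := by
  refine ((Lp.memLp u).norm.const_mul C).mono
    (((continuous_deriv_of_contDiff hf).comp_aestronglyMeasurable
      (Lp.aestronglyMeasurable Z)).smul (Lp.aestronglyMeasurable u))
    (.of_forall fun ω => le_trans ?_ (le_abs_self _))
  rw [norm_smul]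
  exact mul_le_mul_of_nonneg_right (hC _) (norm_nonneg _)

/-- The chain rule `D f(Z) = f'(Z) DZ`. -/
theorem comp_mem_derivGraph (hX : IsIsonormal X μ) [IsProbabilityMeasure μ]
    (hf : ContDiff ℝ ((⊤ : ℕ∞) : WithTop ℕ∞) f) (hC : ∀ x, ‖_root_.deriv f x‖ ≤ C)
    {Z : Lp ℝ 2 μ} {u : Lp H 2 μ} (hZ : (Z, u) ∈ derivGraph X μ) :
    ((memLp_comp_of_norm_deriv_le hf hC Z).toLp _, (memLp_deriv_comp_smul hf hC Z u).toLp _)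
      ∈ derivGraph X μ := by
  obtain ⟨p, hp, hlim⟩ := mem_closure_iff_seq_limit.1 hZ
  have hC0 : 0 ≤ C := (norm_nonneg _).trans (hC 0)
  have hmeas := tendstoInMeasure_of_tendsto_Lp
    ((continuous_fst.tendsto _).comp hlim : Tendsto (fun k => (p k).1) atTop (𝓝 Z))
  -- Almost sure convergence, available along a subsequence, is what makes the continuous factor
  -- `f'` converge.
  obtain ⟨ns, hns, hae⟩ := hmeas.exists_seq_tendsto_ae
  have hlim' := hlim.comp hns.tendsto_atTop
  set q : ℕ → Lp ℝ 2 μ × Lp H 2 μ := p ∘ ns with hq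
  have hq1 : Tendsto (fun k => (q k).1) atTop (𝓝 Z) := (continuous_fst.tendsto _).comp hlim'
  have hq2 : Tendsto (fun k => (q k).2) atTop (𝓝 u) := (continuous_snd.tendsto _).comp hlim'
  have hmem : ∀ k, ((memLp_comp_of_norm_deriv_le hf hC (q k).1).toLp _,
      (memLp_deriv_comp_smul hf hC (q k).1 (q k).2).toLp _) ∈ derivGraph X μ := by
    intro k
    obtain ⟨n, φ, F, hF, hc, h1, h2⟩ := hp (ns k)
    refine smoothGraph_subset_derivGraph hX
      ⟨_, _, SmoothPair.comp_of_hasCompactSupport φ hF hc hf, ?_, ?_⟩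
    · filter_upwards [MemLp.coeFn_toLp (memLp_comp_of_norm_deriv_le hf hC (q k).1), h1] with ω a b
      rw [a]
      exact congrArg f b
    · filter_upwards [MemLp.coeFn_toLp (memLp_deriv_comp_smul hf hC (q k).1 (q k).2), h1, h2]
        with ω a b c
      rw [a]
      exact congrArg₂ (fun x y => _root_.deriv f x • y) b c
  have t1 : Tendsto (fun k => (memLp_comp_of_norm_deriv_le hf hC (q k).1).toLp _) atTop
      (𝓝 ((memLp_comp_of_norm_deriv_le hf hC Z).toLp _)) := by
    rw [tendsto_iff_norm_sub_tendsto_zero] at hq1 ⊢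
    refine squeeze_zero (fun _ => norm_nonneg _) (fun k => ?_) (by simpa using hq1.const_mul C)
    refine Lp.norm_le_mul_norm_of_ae_le_mul ?_
    filter_upwards [MemLp.coeFn_toLp (memLp_comp_of_norm_deriv_le hf hC (q k).1),
      MemLp.coeFn_toLp (memLp_comp_of_norm_deriv_le hf hC Z),
      Lp.coeFn_sub ((memLp_comp_of_norm_deriv_le hf hC (q k).1).toLp _)
        ((memLp_comp_of_norm_deriv_le hf hC Z).toLp _), Lp.coeFn_sub (q k).1 Z] with ω a b c d
    rw [c, d, Pi.sub_apply, Pi.sub_apply, a, b]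
    exact norm_sub_le_of_norm_deriv_le hf hC _ _
  -- The derivative is split as `f'(F_k) u + f'(F_k) (u_k - u)`: dominated convergence for the first
  -- term, boundedness of `f'` for the second.
  have t2 : Tendsto (fun k => (memLp_deriv_comp_smul hf hC (q k).1 u).toLp _) atTop
      (𝓝 ((memLp_deriv_comp_smul hf hC Z u).toLp _)) := by
    rw [Lp.tendsto_Lp_iff_tendsto_eLpNorm'']
    refine tendsto_eLpNorm_two_of_dominated (b := fun ω => (C + C) * ‖u ω‖)
      (fun k => (memLp_deriv_comp_smul hf hC (q k).1 u).1) (memLp_deriv_comp_smul hf hC Z u).1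
      ((Lp.memLp u).norm.const_mul _) (fun k => .of_forall fun ω => ?_) ?_
    · rw [← sub_smul, norm_smul]
      exact mul_le_mul_of_nonneg_right ((norm_sub_le _ _).trans (add_le_add (hC _) (hC _)))
        (norm_nonneg _)
    · filter_upwards [hae] with ω hω
      exact (((continuous_deriv_of_contDiff hf).tendsto _).comp hω).smul_const _
  have t3 : Tendsto (fun k => (memLp_deriv_comp_smul hf hC (q k).1 (q k).2).toLp _ -
      (memLp_deriv_comp_smul hf hC (q k).1 u).toLp _) atTop (𝓝 0) := by
    rw [tendsto_iff_norm_sub_tendsto_zero] at hq2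
    rw [tendsto_zero_iff_norm_tendsto_zero]
    refine squeeze_zero (fun _ => norm_nonneg _) (fun k => ?_) (by simpa using hq2.const_mul C)
    refine Lp.norm_le_mul_norm_of_ae_le_mul ?_
    filter_upwards [MemLp.coeFn_toLp (memLp_deriv_comp_smul hf hC (q k).1 (q k).2),
      MemLp.coeFn_toLp (memLp_deriv_comp_smul hf hC (q k).1 u),
      Lp.coeFn_sub ((memLp_deriv_comp_smul hf hC (q k).1 (q k).2).toLp _)
        ((memLp_deriv_comp_smul hf hC (q k).1 u).toLp _), Lp.coeFn_sub (q k).2 u] with ω a b c d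
    rw [c, d, Pi.sub_apply, Pi.sub_apply, a, b, ← smul_sub, norm_smul]
    exact mul_le_mul_of_nonneg_right (hC _) (norm_nonneg _)
  have t4 := t2.add t3
  simp only [add_sub_cancel, add_zero] at t4
  exact isClosed_closure.mem_of_tendsto (t1.prodMk_nhds t4) (.of_forall hmem)

theorem integrable_carre (Z : Lp ℝ 2 μ) : Integrable (carre X μ Z) μ := by
  have := L2.integrable_inner (𝕜 := ℝ) (deriv X μ Z) (-deriv X μ (invL X μ Z))
  refine this.congr ?_
  filter_upwards [Lp.coeFn_neg (deriv X μ (invL X μ Z))] with ω hω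
  rw [hω, carre, Pi.neg_apply]

theorem integral_comp_mul_eq_carre [CompleteSpace H] (hX : IsIsonormal X μ)
    [IsProbabilityMeasure μ] (hf : ContDiff ℝ ((⊤ : ℕ∞) : WithTop ℕ∞) f)
    (hC : ∀ x, ‖_root_.deriv f x‖ ≤ C) {Z : Lp ℝ 2 μ} (hZ : Z ∈ D12 X μ)
    (hmean : ∫ ω, Z ω ∂μ = 0) :
    ∫ ω, f (Z ω) * Z ω ∂μ = ∫ ω, _root_.deriv f (Z ω) * carre X μ Z ω ∂μ := by
  obtain ⟨u, hu⟩ := hZ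
  have h := invL_spec hX hmean (comp_mem_derivGraph hX hf hC hu)
  rw [L2.inner_def, L2.inner_def] at h
  have e1 : ∫ ω, inner ℝ ((memLp_comp_of_norm_deriv_le hf hC Z).toLp _ ω) (Z ω) ∂μ
      = ∫ ω, f (Z ω) * Z ω ∂μ := by
    refine integral_congr_ae ?_
    filter_upwards [MemLp.coeFn_toLp (memLp_comp_of_norm_deriv_le hf hC Z)] with ω a
    rw [a]
    simp [mul_comm]
  rw [← e1, ← h]
  refine integral_congr_ae ?_
  filter_upwards [MemLp.coeFn_toLp (memLp_deriv_comp_smul hf hC Z u),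
    Lp.coeFn_neg (deriv X μ (invL X μ Z))] with ω a b
  rw [a, b, carre, deriv_eq hX hu, inner_smul_left]
  simp

/-- The integration by parts formula for the law of `Z`. -/
theorem IsG.integral_law [CompleteSpace H] (hX : IsIsonormal X μ)
    [IsProbabilityMeasure μ] (hf : ContDiff ℝ ((⊤ : ℕ∞) : WithTop ℕ∞) f)
    (hC : ∀ x, ‖_root_.deriv f x‖ ≤ C) {Z : Lp ℝ 2 μ} (hZ : Z ∈ D12 X μ)
    (hmean : ∫ ω, Z ω ∂μ = 0) {g : ℝ → ℝ} (hg : IsG X μ Z g) :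
    ∫ x, f x * x ∂(μ.map Z) = ∫ x, _root_.deriv f x * g x ∂(μ.map Z) := by
  have hZm : Measurable (Z : Ω → ℝ) := (Lp.stronglyMeasurable Z).measurable
  have hle : MeasurableSpace.comap (Z : Ω → ℝ) inferInstance ≤ (inferInstance : MeasurableSpace Ω) :=
    hZm.comap_le
  have hd := continuous_deriv_of_contDiff hf
  rw [integral_map (f := fun x => f x * x) hZm.aemeasurable
      (hf.continuous.mul continuous_id).aestronglyMeasurable,
    integral_map (f := fun x => _root_.deriv f x * g x) hZm.aemeasurable
      (hd.measurable.mul hg.1).aestronglyMeasurable,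
    integral_comp_mul_eq_carre hX hf hC hZ hmean]
  have hsm : StronglyMeasurable[MeasurableSpace.comap (Z : Ω → ℝ) inferInstance]
      fun ω => _root_.deriv f (Z ω) :=
    (hd.measurable.comp (comap_measurable _)).stronglyMeasurable
  have hci := integrable_carre (X := X) Z
  have hi : Integrable ((fun ω => _root_.deriv f (Z ω)) * carre X μ Z) μ :=
    hci.bdd_mul (hsm.mono hle).aestronglyMeasurable (.of_forall fun ω => hC _)
  -- `f'(Z)` is measurable with respect to `Z`, so it comes out of the conditional expectation,
  -- leaving `g(Z)`.
  have hpull := condExp_mul_of_stronglyMeasurable_left hsm hi hci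
  rw [← integral_condExp hle (f := fun ω => _root_.deriv f (Z ω) * carre X μ Z ω)]
  refine integral_congr_ae ?_
  filter_upwards [hpull, hg.2] with ω a b
  rw [b]
  exact a

theorem IsG.integrable_law [IsProbabilityMeasure μ] {Z : Lp ℝ 2 μ} {g : ℝ → ℝ}
    (hg : IsG X μ Z g) : Integrable g (μ.map Z) := by
  have hZm : Measurable (Z : Ω → ℝ) := (Lp.stronglyMeasurable Z).measurable
  rw [integrable_map_measure hg.1.aestronglyMeasurable hZm.aemeasurable]
  exact integrable_condExp.congr hg.2.symm

end Malliavin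

/-! ### The density formula on the real line. -/

namespace SteinDensity

/-- The density of `g ν` when `ν` satisfies the integration by parts formula with kernel `g`. -/
def tailMoment (ν : Measure ℝ) (y : ℝ) : ℝ :=
  ∫ x, (Set.uIoc 0 x).indicator (fun _ => |x|) y ∂ν

variable {ν : Measure ℝ}

theorem measurableSet_uIoc_kernel : MeasurableSet {p : ℝ × ℝ | p.2 ∈ Set.uIoc 0 p.1} := by
  have : {p : ℝ × ℝ | p.2 ∈ Set.uIoc 0 p.1}
      = {p | 0 < p.2 ∧ p.2 ≤ p.1} ∪ {p | p.1 < p.2 ∧ p.2 ≤ 0} := by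
    ext p
    simp [Set.mem_uIoc]
  rw [this]
  exact ((measurableSet_lt measurable_const measurable_snd).inter
    (measurableSet_le measurable_snd measurable_fst)).union
    ((measurableSet_lt measurable_fst measurable_snd).inter
    (measurableSet_le measurable_snd measurable_const))

theorem measurable_kernel :
    Measurable fun p : ℝ × ℝ => (Set.uIoc 0 p.1).indicator (fun _ => |p.1|) p.2 := by
  have : (fun p : ℝ × ℝ => (Set.uIoc 0 p.1).indicator (fun _ => |p.1|) p.2)
      = {p : ℝ × ℝ | p.2 ∈ Set.uIoc 0 p.1}.indicator fun p => |p.1| := by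
    rfl
  rw [this]
  exact (by fun_prop : Measurable fun p : ℝ × ℝ => |p.1|).indicator measurableSet_uIoc_kernel

theorem integral_kernel (x : ℝ) : ∫ y, (Set.uIoc 0 x).indicator (fun _ => |x|) y = x ^ 2 := by
  rw [integral_indicator measurableSet_uIoc, setIntegral_const, measureReal_def, Set.uIoc,
    Real.volume_Ioc, ENNReal.toReal_ofReal (by simp), max_sub_min_eq_abs]
  simp [← sq]

/-- The section at `x` is a rectangle of width and height `|x|`, so the second moment is exactly
what Fubini requires. -/
theorem integrable_kernel [SFinite ν] (h2 : Integrable (fun x => x ^ 2) ν) :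
    Integrable (fun p : ℝ × ℝ => (Set.uIoc 0 p.1).indicator (fun _ => |p.1|) p.2)
      (ν.prod volume) := by
  rw [integrable_prod_iff measurable_kernel.aestronglyMeasurable]
  constructor
  · refine .of_forall fun x => ?_
    simp only
    exact (integrable_indicator_iff measurableSet_uIoc).2
      (integrableOn_const (by simp [Set.uIoc]) (by simp))
  · refine h2.congr (.of_forall fun x => ?_)
    have : ∀ y, ‖(Set.uIoc 0 x).indicator (fun _ => |x|) y‖
        = (Set.uIoc 0 x).indicator (fun _ => |x|) y := fun y =>
      Real.norm_of_nonneg (Set.indicator_nonneg (fun _ _ => abs_nonneg _) _)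
    simp only [this, integral_kernel]

theorem tailMoment_nonneg (y : ℝ) : 0 ≤ tailMoment ν y :=
  integral_nonneg fun _ => Set.indicator_nonneg (fun _ _ => abs_nonneg _) _

theorem measurable_tailMoment [SFinite ν] : Measurable (tailMoment ν) := by
  have := (measurable_kernel.stronglyMeasurable).integral_prod_left' (μ := ν)
  exact this.measurable

theorem integrable_tailMoment [SFinite ν] (h2 : Integrable (fun x => x ^ 2) ν) :
    Integrable (tailMoment ν) := (integrable_kernel h2).integral_prod_right

/-- For `y ≤ 0` the kernel selects the points `x < y` instead; only positive `y` matters for the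
upper tail. -/
theorem tailMoment_eq {y : ℝ} (hy : 0 < y) : tailMoment ν y = ∫ x in Set.Ici y, x ∂ν := by
  rw [tailMoment, ← integral_indicator measurableSet_Ici]
  congr 1
  ext x
  by_cases h : y ≤ x
  · have : y ∈ Set.uIoc 0 x := Set.mem_uIoc.2 (.inl ⟨hy, h⟩)
    simp [this, h, abs_of_pos (hy.trans_le h)]
  · have : y ∉ Set.uIoc 0 x := by
      rw [Set.mem_uIoc]; push Not at h ⊢
      exact ⟨fun _ => h, fun _ => hy⟩
    simp [this, h]

theorem integral_mul_eq_integral_tailMoment [IsProbabilityMeasure ν]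
    (h2 : Integrable (fun x => x ^ 2) ν) (h1 : Integrable (fun x => x) ν) (h0 : ∫ x, x ∂ν = 0)
    {f : ℝ → ℝ} (hf : ContDiff ℝ ((⊤ : ℕ∞) : WithTop ℕ∞) f) {C : ℝ}
    (hC : ∀ x, ‖deriv f x‖ ≤ C) :
    ∫ x, f x * x ∂ν = ∫ y, deriv f y * tailMoment ν y := by
  have hd : Continuous (deriv f) := hf.continuous_deriv (by simp)
  have hker : Integrable (fun p : ℝ × ℝ => deriv f p.2 *
      (Set.uIoc 0 p.1).indicator (fun _ => |p.1|) p.2) (ν.prod volume) :=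
    (integrable_kernel h2).bdd_mul (hd.comp continuous_snd).aestronglyMeasurable
      (.of_forall fun p => hC p.2)
  have hswap := integral_integral_swap (f := fun x y => deriv f y *
      (Set.uIoc 0 x).indicator (fun _ => |x|) y) hker
  -- The fundamental theorem of calculus between `0` and `x`; the term in `f 0` disappears after
  -- integration because `ν` is centered.
  have e1 : ∀ x, ∫ y, deriv f y * (Set.uIoc 0 x).indicator (fun _ => |x|) y
      = f x * x - f 0 * x := by
    intro x
    have hft : ∫ y in (0 : ℝ)..x, deriv f y = f x - f 0 :=
      intervalIntegral.integral_deriv_eq_sub (fun y _ => hf.differentiable (by simp) y)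
        (hd.intervalIntegrable _ _)
    have : ∀ y, deriv f y * (Set.uIoc 0 x).indicator (fun _ => |x|) y
        = (Set.uIoc 0 x).indicator (fun y => deriv f y * |x|) y := by
      intro y; by_cases h : y ∈ Set.uIoc 0 x <;> simp [h]
    simp only [this]
    rw [integral_indicator measurableSet_uIoc, integral_mul_const]
    rcases le_total 0 x with hx | hx
    · rw [Set.uIoc_of_le hx, ← intervalIntegral.integral_of_le hx, hft, abs_of_nonneg hx]; ring
    · rw [Set.uIoc_of_ge hx, ← intervalIntegral.integral_of_le hx,
        intervalIntegral.integral_symm, hft, abs_of_nonpos hx]; ring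
  simp only [e1] at hswap
  have hfi : Integrable (fun x => f x * x) ν := by
    have hlin : ∀ x, ‖f x * x‖ ≤ C * x ^ 2 + ‖f 0‖ * |x| := by
      intro x
      have := Convex.norm_image_sub_le_of_norm_deriv_le
        (fun x _ => hf.differentiable (by simp) x) (fun x _ => hC x) convex_univ
        (Set.mem_univ 0) (Set.mem_univ x)
      rw [sub_zero] at this
      have h3 : ‖f x‖ ≤ C * ‖x‖ + ‖f 0‖ := by linarith [norm_sub_norm_le (f x) (f 0)]
      rw [norm_mul, ← sq_abs x, Real.norm_eq_abs x] at *
      nlinarith [abs_nonneg x]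
    exact ((h2.const_mul C).add (h1.abs.const_mul _)).mono'
      (hf.continuous.mul continuous_id).aestronglyMeasurable (.of_forall hlin)
  rw [integral_sub hfi (h1.const_mul _), integral_const_mul, h0, mul_zero, sub_zero] at hswap
  rw [hswap]
  congr 1
  ext y
  rw [integral_const_mul]
  rfl

variable {g : ℝ → ℝ}

theorem integral_withDensity_ofReal {m : Measure ℝ} {p F : ℝ → ℝ} (hp : Measurable p)
    (h0 : ∀ᵐ x ∂m, 0 ≤ p x) :
    ∫ x, F x ∂(m.withDensity fun x => ENNReal.ofReal (p x)) = ∫ x, p x * F x ∂m := by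
  rw [integral_withDensity_eq_integral_toReal_smul (by fun_prop) (by simp)]
  refine integral_congr_ae ?_
  filter_upwards [h0] with x hx
  rw [ENNReal.toReal_ofReal hx, smul_eq_mul]

/-- The Nourdin-Viens formula: the integration by parts formula determines `g ν`. -/
theorem withDensity_eq [IsProbabilityMeasure ν] (h2 : Integrable (fun x => x ^ 2) ν)
    (h1 : Integrable (fun x => x) ν) (h0 : ∫ x, x ∂ν = 0) (hgm : Measurable g)
    (hgi : Integrable g ν) (hg0 : ∀ᵐ x ∂ν, 0 ≤ g x)
    (hibp : ∀ (f : ℝ → ℝ) (C : ℝ), ContDiff ℝ ((⊤ : ℕ∞) : WithTop ℕ∞) f →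
      (∀ x, ‖deriv f x‖ ≤ C) → ∫ x, f x * x ∂ν = ∫ x, deriv f x * g x ∂ν) :
    ν.withDensity (fun x => ENNReal.ofReal (g x))
      = volume.withDensity fun x => ENNReal.ofReal (tailMoment ν x) := by
  have := isFiniteMeasure_withDensity_ofReal hgi.2
  have := isFiniteMeasure_withDensity_ofReal (integrable_tailMoment h2).2
  have htest : ∀ (f : ℝ → ℝ), ContDiff ℝ ((⊤ : ℕ∞) : WithTop ℕ∞) f → (∀ x, ‖deriv f x‖ ≤ 1) →
      ∫ x, deriv f x ∂(ν.withDensity fun x => ENNReal.ofReal (g x))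
        = ∫ x, deriv f x ∂(volume.withDensity fun x => ENNReal.ofReal (tailMoment ν x)) := by
    intro f hf hC
    rw [integral_withDensity_ofReal hgm hg0,
      integral_withDensity_ofReal measurable_tailMoment (.of_forall tailMoment_nonneg)]
    simp only [mul_comm (g _), mul_comm (tailMoment ν _)]
    rw [← hibp f 1 hf hC, integral_mul_eq_integral_tailMoment h2 h1 h0 hf hC]
  -- Cosines and sines are derivatives of admissible test functions, so the two finite measures have
  -- the same characteristic function. At `t = 0` the test function `x` compares the total masses.
  have hcos : ∀ t : ℝ, ∫ x, Real.cos (t * x) ∂(ν.withDensity fun x => ENNReal.ofReal (g x))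
        = ∫ x, Real.cos (t * x) ∂(volume.withDensity fun x => ENNReal.ofReal (tailMoment ν x)) := by
    intro t
    by_cases ht : t = 0
    · have := htest (fun x => x) contDiff_id (by simp)
      simpa [ht] using this
    have hd : deriv (fun x => Real.sin (t * x) / t) = fun x => Real.cos (t * x) := by
      ext x
      have := (((hasDerivAt_id x).const_mul t).sin).div_const t
      simp only [id, mul_one] at this
      rw [mul_div_cancel_right₀ _ ht] at this
      exact this.deriv
    have := htest (fun x => Real.sin (t * x) / t) (by fun_prop)
      (by rw [hd]; exact fun x => Real.abs_cos_le_one _)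
    rwa [hd] at this
  have hsin : ∀ t : ℝ, ∫ x, Real.sin (t * x) ∂(ν.withDensity fun x => ENNReal.ofReal (g x))
        = ∫ x, Real.sin (t * x) ∂(volume.withDensity fun x => ENNReal.ofReal (tailMoment ν x)) := by
    intro t
    by_cases ht : t = 0
    · simp [ht]
    have hd : deriv (fun x => -Real.cos (t * x) / t) = fun x => Real.sin (t * x) := by
      ext x
      have := (((hasDerivAt_id x).const_mul t).cos).neg.div_const t
      simp only [id, mul_one, neg_mul, neg_neg] at this
      rw [mul_div_cancel_right₀ _ ht] at this
      exact this.deriv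
    have := htest (fun x => -Real.cos (t * x) / t) (by fun_prop)
      (by rw [hd]; exact fun x => Real.abs_sin_le_one _)
    rwa [hd] at this
  have hchar : ∀ (m : Measure ℝ) [IsFiniteMeasure m] (t : ℝ), charFun m t
      = (∫ x, Real.cos (t * x) ∂m : ℝ) + (∫ x, Real.sin (t * x) ∂m : ℝ) * Complex.I := by
    intro m _ t
    rw [charFun_apply_real, ← integral_complex_ofReal, ← integral_complex_ofReal,
      ← integral_mul_const, ← integral_add]
    · congr 1
      ext x
      rw [← Complex.ofReal_mul, Complex.exp_mul_I]
      simp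
    · exact (Integrable.of_bound
        (Real.continuous_cos.comp (continuous_const.mul continuous_id)).aestronglyMeasurable 1
        (.of_forall fun x => Real.abs_cos_le_one _)).ofReal
    · exact ((Integrable.of_bound
        (Real.continuous_sin.comp (continuous_const.mul continuous_id)).aestronglyMeasurable 1
        (.of_forall fun x => Real.abs_sin_le_one _)).ofReal).mul_const _
  refine Measure.ext_of_charFun (funext fun t => ?_)
  rw [hchar, hchar, hcos, hsin]

end SteinDensity

/-! ### Lower bounds for the tail moment and the tail probability. -/

namespace SteinDensity

variable {ν : Measure ℝ} {g : ℝ → ℝ} {σ : ℝ}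

theorem setIntegral_Ici_antitone (h1 : Integrable (fun x => x) ν) {a b : ℝ} (ha : 0 ≤ a)
    (hab : a ≤ b) : ∫ x in Set.Ici b, x ∂ν ≤ ∫ x in Set.Ici a, x ∂ν :=
  setIntegral_mono_set h1.integrableOn
    ((ae_restrict_iff' measurableSet_Ici).2 (.of_forall fun _ hx => ha.trans hx))
    (Set.Ici_subset_Ici.2 hab).eventuallyLE

theorem setIntegral_mul_eq (hgm : Measurable g) (hg0 : ∀ᵐ x ∂ν, 0 ≤ g x) [SFinite ν]
    (hden : ν.withDensity (fun x => ENNReal.ofReal (g x))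
      = volume.withDensity fun x => ENNReal.ofReal (tailMoment ν x)) {s : Set ℝ}
    (hs : MeasurableSet s) (F : ℝ → ℝ) :
    ∫ x in s, g x * F x ∂ν = ∫ x in s, tailMoment ν x * F x := by
  have h1 := integral_withDensity_ofReal (m := ν) (F := s.indicator F) hgm hg0
  have h2 := integral_withDensity_ofReal (m := volume) (F := s.indicator F) (p := tailMoment ν)
    measurable_tailMoment (.of_forall tailMoment_nonneg)
  rw [hden, h2] at h1
  rw [← integral_indicator hs, ← integral_indicator hs]
  simp only [Set.indicator_mul_right]
  exact h1.symm

/-- As `g` is bounded away from zero, `ν` is absolutely continuous with respect to `g ν`, which has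
a Lebesgue density. -/
theorem absolutelyContinuous_of_withDensity_eq (hσ : 0 < σ) (hgm : Measurable g)
    (hgσ : ∀ᵐ x ∂ν, σ ^ 2 ≤ g x)
    (hden : ν.withDensity (fun x => ENNReal.ofReal (g x))
      = volume.withDensity fun x => ENNReal.ofReal (tailMoment ν x)) : ν ≪ volume := by
  have h1 : ν ≪ ν.withDensity (fun x => ENNReal.ofReal (g x)) := by
    refine withDensity_absolutelyContinuous' (by fun_prop) ?_
    filter_upwards [hgσ] with x hx
    exact (ENNReal.ofReal_pos.2 (lt_of_lt_of_le (by positivity) hx)).ne'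
  rw [hden] at h1
  exact h1.trans (withDensity_absolutelyContinuous _ _)

theorem exists_isDensityOf [IsFiniteMeasure ν] (hac : ν ≪ volume) :
    ∃ ρ : ℝ → ℝ, Measurable ρ ∧ (∀ x, 0 ≤ ρ x) ∧
      ν = volume.withDensity fun x => ENNReal.ofReal (ρ x) := by
  refine ⟨fun x => (ν.rnDeriv volume x).toReal, (Measure.measurable_rnDeriv _ _).ennreal_toReal,
    fun _ => ENNReal.toReal_nonneg, ?_⟩
  conv_lhs => rw [← Measure.withDensity_rnDeriv_eq ν volume hac]
  refine withDensity_congr_ae ?_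
  filter_upwards [Measure.rnDeriv_lt_top ν volume] with x hx
  rw [ENNReal.ofReal_toReal hx.ne]

/-- A one-step lower bound for the tail moment. -/
theorem tail_step (hσ : 0 < σ) (h1 : Integrable (fun x => x) ν) [IsProbabilityMeasure ν]
    (hgm : Measurable g) (hgi : Integrable g ν) (hgσ : ∀ᵐ x ∂ν, σ ^ 2 ≤ g x)
    (hden : ν.withDensity (fun x => ENNReal.ofReal (g x))
      = volume.withDensity fun x => ENNReal.ofReal (tailMoment ν x))
    {a b : ℝ} (ha : 0 ≤ a) (hab : a ≤ b) :
    (∫ x in Set.Ici a, x ∂ν) * (1 - (b ^ 2 - a ^ 2) / (2 * σ ^ 2)) ≤ ∫ x in Set.Ici b, x ∂ν := by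
  set T := ∫ x in Set.Ici a, x ∂ν with hT
  have hg0 : ∀ᵐ x ∂ν, 0 ≤ g x := hgσ.mono fun x hx => (sq_nonneg σ).trans hx
  have hsplit : T = (∫ x in Set.Ico a b, x ∂ν) + ∫ x in Set.Ici b, x ∂ν := by
    rw [hT, ← Set.Ico_union_Ici_eq_Ici hab, setIntegral_union
      ((Set.Iio_disjoint_Ici le_rfl).mono_left Set.Ico_subset_Iio_self)
      measurableSet_Ici h1.integrableOn h1.integrableOn]
  have hgx : IntegrableOn (fun x => g x * x) (Set.Ico a b) ν := by
    refine Integrable.mul_bdd (c := b) hgi.integrableOn continuous_id.aestronglyMeasurable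
      ((ae_restrict_iff' measurableSet_Ico).2 (.of_forall fun x hx => ?_))
    rw [Real.norm_of_nonneg (ha.trans hx.1)]
    exact hx.2.le
  have e1 : σ ^ 2 * ∫ x in Set.Ico a b, x ∂ν ≤ ∫ x in Set.Ico a b, g x * x ∂ν := by
    rw [← integral_const_mul]
    refine integral_mono_ae (h1.integrableOn.const_mul _) hgx ?_
    refine (ae_restrict_iff' measurableSet_Ico).2 ?_
    filter_upwards [hgσ] with x hx hxm
    exact mul_le_mul_of_nonneg_right hx (ha.trans hxm.1)
  have e2 : ∫ x in Set.Ico a b, g x * x ∂ν = ∫ x in Set.Ico a b, tailMoment ν x * x :=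
    setIntegral_mul_eq hgm hg0 hden measurableSet_Ico _
  have hb : ∀ x ∈ Set.Ico a b, tailMoment ν x * x ≤ T * x := by
    intro x hx
    -- `tailMoment_eq` holds only for positive arguments; at `x = 0` the weight `x` vanishes.
    rcases (ha.trans hx.1).eq_or_lt with h0 | h0
    · simp [← h0]
    · rw [tailMoment_eq h0]
      exact mul_le_mul_of_nonneg_right (setIntegral_Ici_antitone h1 ha hx.1) h0.le
  have hTi : IntegrableOn (fun x : ℝ => T * x) (Set.Ico a b) :=
    ((continuous_const.mul continuous_id).integrableOn_Icc).mono_set Set.Ico_subset_Icc_self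
  have e3 : ∫ x in Set.Ico a b, tailMoment ν x * x ≤ ∫ x in Set.Ico a b, T * x := by
    refine setIntegral_mono_on ?_ hTi measurableSet_Ico hb
    refine hTi.mono' (measurable_tailMoment.mul measurable_id).aestronglyMeasurable
      ((ae_restrict_iff' measurableSet_Ico).2 (.of_forall fun x hx => ?_))
    rw [Real.norm_of_nonneg (mul_nonneg (tailMoment_nonneg _) (ha.trans hx.1))]
    exact hb x hx
  have e4 : ∫ x in Set.Ico a b, T * x = T * ((b ^ 2 - a ^ 2) / 2) := by
    rw [integral_Ico_eq_integral_Ioc, ← intervalIntegral.integral_of_le hab,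
      intervalIntegral.integral_const_mul, integral_id]
  have hσ2 : 0 < σ ^ 2 := by positivity
  have e5 : ∫ x in Set.Ico a b, x ∂ν ≤ T * ((b ^ 2 - a ^ 2) / (2 * σ ^ 2)) := by
    have h := e1.trans (e2.le.trans (e3.trans e4.le))
    have h' : ∫ x in Set.Ico a b, x ∂ν ≤ (T * ((b ^ 2 - a ^ 2) / 2)) / σ ^ 2 := by
      rw [le_div_iff₀ hσ2]; linarith
    refine h'.trans_eq ?_
    field_simp
  linarith

/-- The tail moment decays at most like a Gaussian. -/
theorem tail_lower_bound (hσ : 0 < σ) (h1 : Integrable (fun x => x) ν) [IsProbabilityMeasure ν]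
    (hgm : Measurable g) (hgi : Integrable g ν) (hgσ : ∀ᵐ x ∂ν, σ ^ 2 ≤ g x)
    (hden : ν.withDensity (fun x => ENNReal.ofReal (g x))
      = volume.withDensity fun x => ENNReal.ofReal (tailMoment ν x)) {z : ℝ} (hz : 0 ≤ z) :
    (∫ x in Set.Ici 0, x ∂ν) * Real.exp (-(z ^ 2) / (2 * σ ^ 2)) ≤ ∫ x in Set.Ici z, x ∂ν := by
  set T : ℝ → ℝ := fun a => ∫ x in Set.Ici a, x ∂ν with hT
  set c := z ^ 2 / (2 * σ ^ 2) with hc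
  have hstep : ∀ n : ℕ, c < n → T 0 * (1 + -c / n) ^ n ≤ T z := by
    intro n hn
    have hc0 : 0 ≤ c := by positivity
    have hn0 : (0 : ℝ) < n := hc0.trans_lt hn
    have hfac : 0 ≤ 1 + -c / n := by
      rw [neg_div, ← sub_eq_add_neg, sub_nonneg, div_le_one hn0]
      exact hn.le
    -- The points have equally spaced squares, so each application of `tail_step` costs the same
    -- factor `1 - c / n`, nonnegative because `c < n`.
    have hind : ∀ i : ℕ, T 0 * (1 + -c / n) ^ i ≤ T (√(i / n) * z) := by
      intro i
      induction i with
      | zero => simp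
      | succ i ih =>
        have hle : √((i : ℝ) / n) * z ≤ √(((i + 1 : ℕ) : ℝ) / n) * z := by
          gcongr
          omega
        have hs := tail_step hσ h1 hgm hgi hgσ hden (by positivity) hle
        refine le_trans ?_ hs
        have hsq : 1 - ((√(((i + 1 : ℕ) : ℝ) / n) * z) ^ 2 - (√((i : ℝ) / n) * z) ^ 2)
            / (2 * σ ^ 2) = 1 + -c / n := by
          rw [mul_pow, mul_pow, Real.sq_sqrt (by positivity), Real.sq_sqrt (by positivity), hc]
          push_cast
          field_simp
          ring
        rw [hsq, pow_succ, ← mul_assoc]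
        exact mul_le_mul_of_nonneg_right ih hfac
    have := hind n
    rwa [div_self hn0.ne', Real.sqrt_one, one_mul] at this
  have hlim := (Real.tendsto_one_add_div_pow_exp (-c)).const_mul (T 0)
  have hfin := le_of_tendsto hlim (by
    filter_upwards [eventually_gt_atTop ⌈c⌉₊] with n hn
    exact hstep n ((Nat.le_ceil c).trans_lt (by exact_mod_cast hn)))
  rwa [hc, ← neg_div] at hfin

theorem setIntegral_Ici_zero (h1 : Integrable (fun x => x) ν) (h0 : ∫ x, x ∂ν = 0) :
    ∫ x in Set.Ici 0, x ∂ν = 1 / 2 * ∫ x, |x| ∂ν := by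
  have h2 : ∀ x : ℝ, (Set.Ici 0).indicator (fun x => x) x = 1 / 2 * (|x| + x) := by
    intro x
    by_cases h : 0 ≤ x
    · simp [h, abs_of_nonneg h]; ring
    · simp [h, abs_of_neg (not_le.1 h)]
  rw [← integral_indicator measurableSet_Ici]
  simp only [h2]
  rw [integral_const_mul, integral_add h1.abs h1, h0, add_zero]

/-- Otherwise `ν` would be the unit mass at `0`, which absolute continuity excludes. -/
theorem integral_abs_pos (h1 : Integrable (fun x => x) ν) [IsProbabilityMeasure ν]
    (hac : ν ≪ volume) : 0 < ∫ x, |x| ∂ν := by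
  refine (integral_nonneg fun x => abs_nonneg x).lt_of_ne' fun h => ?_
  have h2 := (integral_eq_zero_iff_of_nonneg (fun x => abs_nonneg x) h1.abs).1 h
  have h3 : ν {0}ᶜ = 0 := by
    refine measure_mono_null (fun x hx => ?_) (ae_iff.1 h2)
    simpa using hx
  have h4 : ν {0} = 0 := hac (by simp)
  have h5 := measure_add_measure_compl (μ := ν) (measurableSet_singleton (0 : ℝ))
  rw [h3, h4, measure_univ] at h5
  simp at h5

/-- Comparison of the tail moment with the tail probability. -/
theorem setIntegral_Ici_le_of_antitoneOn {ρ : ℝ → ℝ} {α β : ℝ} (hα : 0 < α) (hβ : 1 < β)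
    (hρm : Measurable ρ) (hρ0 : ∀ x, 0 ≤ ρ x) [IsProbabilityMeasure ν]
    (hν : ν = volume.withDensity fun x => ENNReal.ofReal (ρ x))
    (h1 : Integrable (fun x => x) ν)
    (hanti : AntitoneOn (fun x : ℝ => x ^ (1 + β) * ρ x) (Set.Ici α)) {z : ℝ} (hz : α ≤ z) :
    (1 - 1 / β) * ∫ x in Set.Ici z, x ∂ν ≤ z * ν.real (Set.Ici z) := by
  have hz0 : 0 < z := hα.trans_le hz
  have hβ0 : 0 < β := by linarith
  have hβ1 : 0 < β - 1 := by linarith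
  -- Chosen so that `x - c * z` has zero integral over `(z, ∞)` against `x ^ (-1 - β)`, see `hzero`.
  -- Moreover `c ≥ 1` keeps `c * z` in the region of monotonicity.
  set c := β / (β - 1) with hc
  have hc1 : 1 ≤ c := by rw [hc, le_div_iff₀ hβ1]; linarith
  have hcz : z ≤ c * z := le_mul_of_one_le_left hz0.le hc1
  set r : ℝ → ℝ := fun x => x ^ (1 + β) * ρ x with hr
  have key : ∀ F : ℝ → ℝ, ∫ x in Set.Ici z, F x ∂ν = ∫ x in Set.Ioi z, ρ x * F x := by
    intro F
    have := integral_withDensity_ofReal (m := volume) (F := (Set.Ici z).indicator F) hρm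
      (.of_forall hρ0)
    rw [← hν] at this
    rw [← integral_Ici_eq_integral_Ioi, ← integral_indicator measurableSet_Ici,
      ← integral_indicator measurableSet_Ici, this]
    simp only [Set.indicator_mul_right]
  have hint : ∀ F : ℝ → ℝ, Integrable F ν → Integrable (fun x => ρ x * F x) := by
    intro F hF
    rw [hν, integrable_withDensity_iff_integrable_smul₀' (by fun_prop) (by simp)] at hF
    refine hF.congr (.of_forall fun x => ?_)
    simp only [ENNReal.toReal_ofReal (hρ0 x), smul_eq_mul]
  have hreal : ν.real (Set.Ici z) = ∫ x in Set.Ioi z, ρ x * 1 := by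
    rw [← key fun _ => 1]; simp
  have i1 : IntegrableOn (fun x => ρ x * x) (Set.Ioi z) := (hint _ h1).integrableOn
  have i2 : IntegrableOn (fun x => ρ x * 1) (Set.Ioi z) := (hint _ (integrable_const 1)).integrableOn
  have j1 : IntegrableOn (fun x : ℝ => x ^ (-β)) (Set.Ioi z) :=
    integrableOn_Ioi_rpow_of_lt (by linarith) hz0
  have j2 : IntegrableOn (fun x : ℝ => x ^ (-1 - β)) (Set.Ioi z) :=
    integrableOn_Ioi_rpow_of_lt (by linarith) hz0
  have hpt : ∀ x ∈ Set.Ioi z, ρ x * x - c * z * (ρ x * 1)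
      ≤ r (c * z) * (x ^ (-β) - c * z * x ^ (-1 - β)) := by
    intro x hx
    have hx0 : 0 < x := hz0.trans hx
    have hρx : ρ x = x ^ (-1 - β) * r x := by
      simp only [hr]
      rw [← mul_assoc, ← Real.rpow_add hx0]; simp
    have hxp : x ^ (-β) = x * x ^ (-1 - β) := by
      rw [← Real.rpow_one_add' hx0.le (by linarith)]; congr 1; ring
    have hpos : 0 < x ^ (-1 - β) := Real.rpow_pos_of_pos hx0 _
    -- The Chebyshev argument: `x - c * z` and `r x - r (c * z)` have opposite signs, so `r x` may
    -- be replaced by the constant `r (c * z)`.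
    have hprod : (x - c * z) * (r x - r (c * z)) ≤ 0 := by
      rcases le_total x (c * z) with h | h
      · exact mul_nonpos_of_nonpos_of_nonneg (by linarith)
          (sub_nonneg.2 (hanti (hz.trans (le_of_lt hx)) (hz.trans hcz) h))
      · exact mul_nonpos_of_nonneg_of_nonpos (by linarith)
          (sub_nonpos.2 (hanti (hz.trans hcz) (hz.trans (le_of_lt hx)) h))
    rw [hρx, hxp]
    nlinarith [mul_nonpos_of_nonneg_of_nonpos hpos.le hprod]
  have hle := setIntegral_mono_on (i1.sub (i2.const_mul (c * z)))
    ((j1.sub (j2.const_mul (c * z))).const_mul (r (c * z))) measurableSet_Ioi hpt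
  simp only [Pi.sub_apply] at hle
  rw [integral_sub i1 (i2.const_mul _), integral_const_mul, integral_const_mul,
    integral_sub j1 (j2.const_mul _), integral_const_mul,
    integral_Ioi_rpow_of_lt (by linarith) hz0, integral_Ioi_rpow_of_lt (by linarith) hz0,
    ← key, ← hreal] at hle
  have hzero : -z ^ (-β + 1) / (-β + 1) - c * z * (-z ^ (-1 - β + 1) / (-1 - β + 1)) = 0 := by
    have e1 : z ^ (-β + 1) = z * z ^ (-β) := by
      rw [← Real.rpow_one_add' hz0.le (by linarith)]; congr 1; ring
    have e2 : (-1 - β + 1) = -β := by ring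
    rw [e1, e2, hc]
    have : -β + 1 ≠ 0 := by linarith
    have : β - 1 ≠ 0 := hβ1.ne'
    field_simp
    ring
  rw [hzero, mul_zero] at hle
  have hcinv : (1 - 1 / β) * c = 1 := by
    rw [hc]; field_simp
  have hfac : 0 ≤ 1 - 1 / β := by
    rw [sub_nonneg, div_le_one hβ0]; exact hβ.le
  calc (1 - 1 / β) * ∫ x in Set.Ici z, x ∂ν
      ≤ (1 - 1 / β) * (c * z * ν.real (Set.Ici z)) :=
        mul_le_mul_of_nonneg_left (by linarith) hfac
    _ = ((1 - 1 / β) * c) * (z * ν.real (Set.Ici z)) := by ring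
    _ = z * ν.real (Set.Ici z) := by rw [hcinv, one_mul]

/-- Lower bound of the tail probability from an upper bound of `g` on a unit interval. -/
theorem tail_le_mul_measure (h1 : Integrable (fun x => x) ν) [IsProbabilityMeasure ν]
    (hgm : Measurable g) (hgi : Integrable g ν) (hg0 : ∀ᵐ x ∂ν, 0 ≤ g x)
    (hden : ν.withDensity (fun x => ENNReal.ofReal (g x))
      = volume.withDensity fun x => ENNReal.ofReal (tailMoment ν x))
    {z M : ℝ} (hz : 0 < z) (hM0 : 0 ≤ M) (hM : ∀ x ∈ Set.Ico z (z + 1), g x ≤ M) :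
    ∫ x in Set.Ici (z + 1), x ∂ν ≤ M * ν.real (Set.Ici z) := by
  have e := setIntegral_mul_eq hgm hg0 hden (measurableSet_Ico (a := z) (b := z + 1)) fun _ => 1
  simp only [mul_one] at e
  have e1 : ∫ x in Set.Ico z (z + 1), g x ∂ν ≤ M * ν.real (Set.Ici z) := by
    calc ∫ x in Set.Ico z (z + 1), g x ∂ν ≤ ∫ _ in Set.Ico z (z + 1), M ∂ν :=
          setIntegral_mono_on hgi.integrableOn (integrable_const _) measurableSet_Ico hM
      _ = M * ν.real (Set.Ico z (z + 1)) := by simp [mul_comm]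
      _ ≤ M * ν.real (Set.Ici z) := by
          gcongr
          · exact measure_ne_top _ _
          · exact Set.Ico_subset_Ici_self
  refine le_trans ?_ (e ▸ e1)
  have hb : ∀ x ∈ Set.Ico z (z + 1), tailMoment ν x ≤ ∫ x in Set.Ici z, x ∂ν := fun x hx => by
    rw [tailMoment_eq (hz.trans_le hx.1)]
    exact setIntegral_Ici_antitone h1 hz.le hx.1
  -- The interval has unit length, so the smallest value of the decreasing tail moment is at most
  -- its integral.
  calc ∫ x in Set.Ici (z + 1), x ∂ν
      = ∫ _ in Set.Ico z (z + 1), (∫ x in Set.Ici (z + 1), x ∂ν) := by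
        simp [measureReal_def]
    _ ≤ ∫ x in Set.Ico z (z + 1), tailMoment ν x := by
        refine setIntegral_mono_on (integrableOn_const (by simp) (by simp)) ?_
          measurableSet_Ico fun x hx => ?_
        · refine (integrableOn_const (C := ∫ x in Set.Ici z, x ∂ν) (by simp) (by simp)).mono'
            measurable_tailMoment.aestronglyMeasurable
            ((ae_restrict_iff' measurableSet_Ico).2 (.of_forall fun x hx => ?_))
          rw [Real.norm_of_nonneg (tailMoment_nonneg _)]
          exact hb x hx
        · rw [tailMoment_eq (hz.trans_le hx.1)]
          exact setIntegral_Ici_antitone h1 (hz.le.trans hx.1) hx.2.le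

theorem exists_eventually_le_exp {α : ℝ} (g : ℝ → ℝ)
    (h : limsup (fun z : ℝ => ((z ^ (-α) * Real.log (g z) : ℝ) : EReal)) atTop < ⊤) :
    ∃ C : ℝ, 0 ≤ C ∧ ∀ᶠ z in atTop, g z ≤ Real.exp (C * z ^ α) := by
  obtain ⟨C, hC, -⟩ := EReal.lt_iff_exists_real_btwn.1 h
  refine ⟨max C 0, le_max_right _ _, ?_⟩
  filter_upwards [eventually_lt_of_limsup_lt hC, eventually_gt_atTop 0] with z hz hz0
  -- `Real.log` carries no upper bound where `g z ≤ 0`, but there the claim is trivial.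
  rcases le_or_gt (g z) 0 with hg | hg
  · exact hg.trans (Real.exp_pos _).le
  rw [← Real.log_le_iff_le_exp hg]
  have h2 : z ^ (-α) * Real.log (g z) < C := by exact_mod_cast hz
  have hp : 0 < z ^ α := Real.rpow_pos_of_pos hz0 _
  rw [Real.rpow_neg hz0.le, inv_mul_lt_iff₀ hp] at h2
  calc Real.log (g z) ≤ z ^ α * C := h2.le
    _ ≤ max C 0 * z ^ α := by rw [mul_comm]; gcongr; exact le_max_left _ _

theorem eventually_growth {α a b C : ℝ} (hα : α < 2) (hab : a < b) (ha : 0 < a) :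
    ∀ᶠ z : ℝ in atTop, C * (z + 1) ^ α + a * (z + 1) ^ 2 ≤ b * z ^ 2 := by
  have h1 : ∀ᶠ w : ℝ in atTop, C * w ^ α ≤ (b - a) / 2 * w ^ 2 := by
    have hl : Tendsto (fun w : ℝ => C * w ^ (-(2 - α))) atTop (𝓝 0) := by
      simpa using (tendsto_rpow_neg_atTop (y := 2 - α) (by linarith)).const_mul C
    filter_upwards [hl.eventually_le_const (show (0 : ℝ) < (b - a) / 2 by linarith),
      eventually_gt_atTop 0] with w hw hw0
    have : w ^ α = w ^ (-(2 - α)) * w ^ 2 := by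
      rw [← Real.rpow_natCast, ← Real.rpow_add hw0]; congr 1; push_cast; ring
    rw [this, ← mul_assoc]
    exact mul_le_mul_of_nonneg_right hw (sq_nonneg _)
  have h2 := (tendsto_atTop_add_const_right atTop (1 : ℝ) tendsto_id).eventually h1
  -- Half of the gap `b - a` absorbs the power `α < 2`, the other half the shift from `z` to `z +
  -- 1`; `3 * d` comes from `2 * z + 1 ≤ 3 * z`.
  set d := (a + b) / 2 with hd
  have hdb : 0 < b - d := by rw [hd]; linarith
  have hd0 : 0 < d := by rw [hd]; linarith
  filter_upwards [h2, eventually_ge_atTop (3 * d / (b - d)), eventually_ge_atTop 1]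
    with z hz hz2 hz1
  simp only [id] at hz
  rw [div_le_iff₀ hdb] at hz2
  have h3 : C * (z + 1) ^ α + a * (z + 1) ^ 2 ≤ d * (z + 1) ^ 2 := by
    rw [hd]; linarith
  refine h3.trans ?_
  nlinarith

end SteinDensity

end

/-! ### Assembly of the theorem. -/

theorem theorem4p2 {Ω : Type*} [MeasurableSpace Ω] (μ : Measure Ω) [IsProbabilityMeasure μ]
    {H : Type*} [NormedAddCommGroup H] [InnerProductSpace ℝ H] [CompleteSpace H]
    [TopologicalSpace.SeparableSpace H]
    (X : H → Ω → ℝ) (hX : Malliavin.IsIsonormal X μ)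
    (Z : Lp ℝ 2 μ) (hZ : Z ∈ Malliavin.D12 X μ) (hmean : ∫ ω, Z ω ∂μ = 0)
    (g : ℝ → ℝ) (hg : Malliavin.IsG X μ Z g)
    (σmin : ℝ) (hσ : 0 < σmin) (hgσ : ∀ᵐ ω ∂μ, σmin ^ 2 ≤ g (Z ω)) :
    -- the density exists
    (∃ ρ : ℝ → ℝ, IsDensityOf ρ Z μ) ∧
    -- lower bound under monotonicity of `x ^ (1 + β) ρ(x)`
    (∀ α β : ℝ, 0 < α → 1 < β → ∀ ρ : ℝ → ℝ, IsDensityOf ρ Z μ →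
      AntitoneOn (fun x : ℝ => x ^ (1 + β) * ρ x) (Set.Ici α) →
      ∀ z : ℝ, α ≤ z →
        1 / 2 * (1 - 1 / β) * (∫ ω, |Z ω| ∂μ) * (1 / z) * Real.exp (-(z ^ 2) / (2 * σmin ^ 2))
          ≤ μ.real {ω | z ≤ Z ω}) ∧
    -- lower bound under a growth condition on `g`
    (∀ α : ℝ, 0 < α → α < 2 →
      limsup (fun z : ℝ => ((z ^ (-α) * Real.log (g z) : ℝ) : EReal)) atTop < ⊤ →
      ∀ ε : ℝ, 0 < ε → ε < 2 → ∃ K z₀ : ℝ, 0 < K ∧ 0 < z₀ ∧ ∀ z : ℝ, z₀ < z →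
        K * Real.exp (-(z ^ 2) / ((2 - ε) * σmin ^ 2)) ≤ μ.real {ω | z ≤ Z ω}) := by
  have hZm : Measurable (Z : Ω → ℝ) := (Lp.stronglyMeasurable Z).measurable
  have hprob : IsProbabilityMeasure (μ.map Z) := Measure.isProbabilityMeasure_map hZm.aemeasurable
  have h1 : Integrable (fun x => x) (μ.map Z) :=
    (integrable_map_measure (by fun_prop) hZm.aemeasurable).2
      ((Lp.memLp Z).integrable (by simp))
  have h2 : Integrable (fun x => x ^ 2) (μ.map Z) :=
    (integrable_map_measure (by fun_prop) hZm.aemeasurable).2 (Lp.memLp Z).integrable_sq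
  have h0 : ∫ x, x ∂(μ.map Z) = 0 := by
    rw [integral_map (f := fun x => x) hZm.aemeasurable (by fun_prop), hmean]
  have habs : ∫ x, |x| ∂(μ.map Z) = ∫ ω, |Z ω| ∂μ :=
    integral_map (f := fun x => |x|) hZm.aemeasurable (by fun_prop)
  have hgσ' : ∀ᵐ x ∂(μ.map Z), σmin ^ 2 ≤ g x :=
    (ae_map_iff hZm.aemeasurable (measurableSet_le measurable_const hg.1)).2 hgσ
  have hg0 : ∀ᵐ x ∂(μ.map Z), 0 ≤ g x := hgσ'.mono fun x hx => (sq_nonneg _).trans hx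
  have hgi := hg.integrable_law
  have hden := SteinDensity.withDensity_eq h2 h1 h0 hg.1 hgi hg0
    fun f C hf hC => Malliavin.IsG.integral_law hX hf hC hZ hmean hg
  have hac := SteinDensity.absolutelyContinuous_of_withDensity_eq hσ hg.1 hgσ' hden
  have htail := fun {z : ℝ} (hz : 0 ≤ z) =>
    SteinDensity.tail_lower_bound hσ h1 hg.1 hgi hgσ' hden hz
  have hT0 := SteinDensity.setIntegral_Ici_zero h1 h0
  have hpos := SteinDensity.integral_abs_pos h1 hac
  have hreal : ∀ z : ℝ, μ.real {ω | z ≤ Z ω} = (μ.map Z).real (Set.Ici z) := fun z => by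
    rw [map_measureReal_apply hZm measurableSet_Ici]; rfl
  refine ⟨SteinDensity.exists_isDensityOf hac, ?_, ?_⟩
  · intro α β hα hβ ρ hρ hanti z hz
    have hz0 : 0 < z := hα.trans_le hz
    have hfac : 0 ≤ 1 - 1 / β := by
      rw [sub_nonneg, div_le_one (by linarith)]; exact hβ.le
    have hle := SteinDensity.setIntegral_Ici_le_of_antitoneOn hα hβ hρ.1 hρ.2.1 hρ.2.2 h1 hanti hz
    have hlow := htail hz0.le
    rw [hT0, habs] at hlow
    rw [hreal]
    have h3 := (mul_le_mul_of_nonneg_left hlow hfac).trans hle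
    rw [← div_le_iff₀' hz0] at h3
    refine le_of_eq_of_le ?_ h3
    ring
  · intro α hα hα2 hlim ε hε hε2
    obtain ⟨C, hC, hev⟩ := SteinDensity.exists_eventually_le_exp g hlim
    have hσ2 : 0 < σmin ^ 2 := by positivity
    -- This strict gap between the Gaussian rates pays for both the growth of `g` and the unit
    -- shift.
    have hcoef : 1 / (2 * σmin ^ 2) < 1 / ((2 - ε) * σmin ^ 2) :=
      one_div_lt_one_div_of_lt (mul_pos (by linarith) hσ2)
        (mul_lt_mul_of_pos_right (by linarith) hσ2)
    obtain ⟨z₁, hz₁⟩ := eventually_atTop.1 hev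
    obtain ⟨z₂, hz₂⟩ := eventually_atTop.1
      (SteinDensity.eventually_growth (C := C) hα2 hcoef (by positivity))
    -- `K` is the tail moment at `0`, positive by `hpos`; the maximum with `1` keeps `z` positive.
    refine ⟨1 / 2 * ∫ x, |x| ∂(μ.map Z), max (max z₁ z₂) 1, by positivity, by positivity,
      fun z hz => ?_⟩
    have hz1 : z₁ ≤ z := ((le_max_left _ _).trans (le_max_left _ _)).trans hz.le
    have hz2 : z₂ ≤ z := ((le_max_right _ _).trans (le_max_left _ _)).trans hz.le
    have hz0 : 0 < z := zero_lt_one.trans ((le_max_right _ _).trans_lt hz)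
    have hM : ∀ x ∈ Set.Ico z (z + 1), g x ≤ Real.exp (C * (z + 1) ^ α) := fun x hx => by
      refine (hz₁ x (hz1.trans hx.1)).trans (Real.exp_le_exp.2 ?_)
      have hx0 : 0 ≤ x := hz0.le.trans hx.1
      exact mul_le_mul_of_nonneg_left (Real.rpow_le_rpow hx0 hx.2.le hα.le) hC
    have hle := SteinDensity.tail_le_mul_measure h1 hg.1 hgi hg0 hden hz0 (Real.exp_pos _).le hM
    have hlow := (htail (z := z + 1) (by positivity)).trans hle
    rw [hT0] at hlow
    rw [hreal, ← mul_le_mul_iff_of_pos_left (Real.exp_pos (C * (z + 1) ^ α))]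
    refine le_trans ?_ hlow
    rw [mul_left_comm, ← Real.exp_add]
    refine mul_le_mul_of_nonneg_left (Real.exp_le_exp.2 ?_) (by positivity)
    have := hz₂ z hz2
    have e1 : -(z ^ 2) / ((2 - ε) * σmin ^ 2) = -(1 / ((2 - ε) * σmin ^ 2) * z ^ 2) := by ring
    have e2 : -((z + 1) ^ 2) / (2 * σmin ^ 2) = -(1 / (2 * σmin ^ 2) * (z + 1) ^ 2) := by ring
    rw [e1, e2]
    linarith
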